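/- Let $k$ be a field of characteristic $0$. Let $Q_A$ be a finite quiver and let $Q_B$ be a subquiver of $Q_A$ with the same vertices. Let $A\cong kQ_A/J^2$ be the radical square zero algebra of $Q_A$, where $J$ is the ideal generated by the arrows, and let $B\subseteq A$ be the subalgebra generated by the vertices and the arrows of $Q_B$, which is the radical square zero algebra of $Q_B$. Let $\mathrm{HH}^1(A|B)=\mathrm{Der}_{B^e}(A)/\mathrm{Inn}_{B^e}(A)$ be the Lie algebra of the $k$-derivations of $A$ that are $B$-bimodule homomorphisms, modulo the inner derivations that are $B$-bimodule homomorphisms. Let $Q_C$ be the quiver with the vertices of $Q_A$ and the arrows of $Q_A$ that are not in $Q_B$. For a class $[\alpha]$ of parallel arrows of $Q_C$ let $|\alpha|$ be its cardinality. Let $S$ be the set of the classes with $|\alpha|>1$, let $\overline{E}$ be the set of the classes that are parallel to at least one arrow of $Q_B$, and let $\overline{D}$ be the set of the remaining classes. Write $\mathcal B$ for the set of paths of $Q_A$ of length at most $1$ (a basis of $A$). For a set $X$ of paths of $Q_A$ let $k(X//\mathcal B)$ be the vector space with basis the symbols $x//q$, for $x\in X$ and $q\in\mathcal B$ parallel to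 $x$. For arrows, the symbol $a//b$ stands for the derivation of $A$ with $a\mapsto b$ that kills the vertices and the other arrows, so that $[a//b,c//d]=\delta_{d,a}\,c//b-\delta_{b,c}\,a//d$. For a class $[\alpha]$ of $Q_C$ put $$\mathfrak I_\alpha=\langle a//b : a\in[\alpha],\ b \text{ an arrow of } Q_B \text{ parallel to } \alpha\rangle_k,\qquad I_\alpha=\sum_{a\in[\alpha]}a//a ,$$ and regard $\mathfrak{sl}_{|\alpha|}(k)$ as the trace zero part of $\mathfrak{gl}_{|\alpha|}(k)=\langle a//a' : a,a'\in[\alpha]\rangle_k$. Let $$\delta^0_A\colon k((Q_A)_0//\mathcal B)\to k((Q_A)_1//\mathcal B),\qquad \delta^0_A(e//q)=\sum_{s(a)=e,\ aq\in\mathcal B}a//aq-\sum_{t(a)=e,\ qa\in\mathcal B}a//qa$$ (paths are composed from right to left), and let $\mathrm{Im}(\delta^0_{A|B})$ be the space of the elements of $\mathrm{Im}(\delta^0_A)$ in which no arrow $a$ of $Q_B$ occurs in a term $a//q$; it is contained in $\prod_{[\alpha]\in\overline D}kI_\alpha$. Then there is an isomorphism of Lie algebras $$\mathrm{HH}^1(A|B)\;\cong\;\prod_{[\alpha]\in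 S}\mathfrak{sl}_{|\alpha|}(k)\ltimes\Bigl(\Bigl(\prod_{[\alpha]\in\overline E}\mathfrak I_\alpha\rtimes kI_\alpha\Bigr)\times\mathfrak a\Bigr),\qquad \mathfrak a=\Bigl(\prod_{[\alpha]\in\overline D}kI_\alpha\Bigr)\Big/\mathrm{Im}(\delta^0_{A|B}),$$ where $\mathfrak a$ is abelian. In the semidirect products, $kI_\alpha$ acts on $\mathfrak I_\alpha$ by the bracket above, and so does $\mathfrak{sl}_{|\alpha|}(k)$ for $[\alpha]\in S\cap\overline E$; all other actions of the factors $\mathfrak{sl}_{|\alpha|}(k)$ are zero. -/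

import Mathlib

noncomputable section

namespace RelHH

attribute [local instance] LieRing.ofAssociativeRing

/-! ### Products of Lie algebras -/

section PiLie

variable {ι : Type*} {L : ι → Type*} [∀ i, LieRing (L i)]

/-- The product of a family of Lie rings, with the componentwise bracket. -/
instance piLieRing : LieRing (∀ i, L i) where
  bracket x y := fun i => ⁅x i, y i⁆
  add_lie x y z := funext fun i => add_lie (x i) (y i) (z i)
  lie_add x y z := funext fun i => lie_add (x i) (y i) (z i)
  lie_self x := funext fun i => lie_self (x i)
  leibniz_lie x y z := funext fun i => leibniz_lie (x i) (y i) (z i)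

theorem pi_lie_apply (x y : ∀ i, L i) (i : ι) : ⁅x, y⁆ i = ⁅x i, y i⁆ := rfl

instance piLieAlgebra {k : Type*} [CommRing k] [∀ i, LieAlgebra k (L i)] :
    LieAlgebra k (∀ i, L i) where
  lie_smul t x y := funext fun i => lie_smul t (x i) (y i)

end PiLie

/-! ### The first relative Hochschild cohomology -/

section HH1

variable (k : Type*) [CommRing k] {A : Type*} [Ring A] [Algebra k A]

/-- `Der_{B^e}(A)`: the `k`-derivations `A → A` that are homomorphisms of `B`-bimodules, with the
commutator bracket.  These are the 1-cocycles of the relative bar complex. -/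
def relDer (B : Subalgebra k A) : LieSubalgebra k (Module.End k A) where
  carrier := {f | (∀ x y : A, f (x * y) = x * f y + f x * y) ∧
    (∀ b ∈ B, ∀ x : A, f (b * x) = b * f x) ∧ (∀ b ∈ B, ∀ x : A, f (x * b) = f x * b)}
  add_mem' := by
    rintro f g ⟨hf, hf', hf''⟩ ⟨hg, hg', hg''⟩
    refine ⟨fun x y => ?_, fun b hb x => ?_, fun b hb x => ?_⟩
    · simp only [LinearMap.add_apply, hf, hg, mul_add, add_mul]; abel
    · simp only [LinearMap.add_apply, hf' b hb, hg' b hb, mul_add]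
    · simp only [LinearMap.add_apply, hf'' b hb, hg'' b hb, add_mul]
  zero_mem' := by simp
  smul_mem' := by
    rintro c f ⟨hf, hf', hf''⟩
    refine ⟨fun x y => ?_, fun b hb x => ?_, fun b hb x => ?_⟩
    · simp [LinearMap.smul_apply, hf]
    · simp [LinearMap.smul_apply, hf' b hb]
    · simp [LinearMap.smul_apply, hf'' b hb]
  lie_mem' := by
    rintro f g ⟨hf, hf', hf''⟩ ⟨hg, hg', hg''⟩
    refine ⟨fun x y => ?_, fun b hb x => ?_, fun b hb x => ?_⟩
    · simp only [Ring.lie_def, LinearMap.sub_apply, Module.End.mul_apply, hf, hg, map_add,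
        mul_sub, sub_mul]
      abel
    · simp only [Ring.lie_def, LinearMap.sub_apply, Module.End.mul_apply, hf' b hb, hg' b hb,
        mul_sub]
    · simp only [Ring.lie_def, LinearMap.sub_apply, Module.End.mul_apply, hf'' b hb, hg'' b hb,
        sub_mul]

/-- `Inn_{B^e}(A)`: the inner derivations `[x, -]` that are homomorphisms of `B`-bimodules. -/
def relInn (B : Subalgebra k A) : LieIdeal k (relDer k B) where
  carrier := {f | ∃ x : A, ∀ y : A, f.1 y = x * y - y * x}
  add_mem' := by
    rintro f g ⟨x, hx⟩ ⟨z, hz⟩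
    refine ⟨x + z, fun y => ?_⟩
    have : (f + g).1 y = f.1 y + g.1 y := rfl
    rw [this, hx, hz, add_mul, mul_add]; abel
  zero_mem' := ⟨0, fun y => by simp⟩
  smul_mem' := by
    rintro c f ⟨x, hx⟩
    refine ⟨c • x, fun y => ?_⟩
    have : (c • f).1 y = c • f.1 y := rfl
    rw [this, hx, smul_sub, smul_mul_assoc, mul_smul_comm]
  lie_mem := by
    rintro f g ⟨x, hx⟩
    refine ⟨f.1 x, fun y => ?_⟩
    have : (⁅f, g⁆ : relDer k B).1 y = f.1 (g.1 y) - g.1 (f.1 y) := rfl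
    rw [this, hx, hx, map_sub, f.2.1, f.2.1]
    abel

/-- The Lie algebra `HH¹(A|B) = Der_{B^e}(A) / Inn_{B^e}(A)`. -/
abbrev HH1 (B : Subalgebra k A) : Type _ := relDer k B ⧸ relInn k B

end HH1

/-! ### Path algebras and radical square zero algebras -/

section PathAlgebra

open Quiver

/-- The underlying space of the path algebra `kQ` of a quiver with finitely many vertices: an
element is a finite linear combination of paths `i → j` for all vertices `i`, `j`. -/
def PathAlgebra (k V : Type*) [Semiring k] [Quiver V] : Type _ :=
  ∀ i j : V, Path i j →₀ k

namespace PathAlgebra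

variable {k V : Type*} [CommRing k] [Quiver V]

instance : AddCommGroup (PathAlgebra k V) :=
  inferInstanceAs (AddCommGroup (∀ i j : V, Path i j →₀ k))

instance : Module k (PathAlgebra k V) :=
  inferInstanceAs (Module k (∀ i j : V, Path i j →₀ k))

/-- Bilinear extension of the concatenation of paths (first `i → l`, then `l → j`). -/
def compL (i l j : V) : (Path i l →₀ k) →ₗ[k] (Path l j →₀ k) →ₗ[k] (Path i j →₀ k) :=
  Finsupp.linearCombination k fun p : Path i l => Finsupp.lmapDomain k k fun q => p.comp q

theorem compL_single {i l j : V} (p : Path i l) (q : Path l j) (c d : k) :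
    compL i l j (Finsupp.single p c) (Finsupp.single q d) = Finsupp.single (p.comp q) (c * d) := by
  simp [compL, Finsupp.mapDomain_single]

theorem compL_assoc {i l m j : V} (x : Path i l →₀ k) (y : Path l m →₀ k) (z : Path m j →₀ k) :
    compL i m j (compL i l m x y) z = compL i l j x (compL l m j y z) := by
  induction x using Finsupp.induction_linear with
  | zero => simp
  | add x x' h h' => simp [h, h']
  | single p c =>
    induction y using Finsupp.induction_linear with
    | zero => simp
    | add y y' h h' => simp [h, h']
    | single q d =>
      induction z using Finsupp.induction_linear with
      | zero => simp
      | add z z' h h' => simp only [map_add, h, h']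
      | single r e => simp only [compL_single, Path.comp_assoc, mul_assoc]

theorem nil_compL {i j : V} (y : Path i j →₀ k) :
    compL i i j (Finsupp.single Path.nil 1) y = y := by
  induction y using Finsupp.induction_linear with
  | zero => simp
  | add y y' h h' => simp [h, h']
  | single q d => simp [compL_single]

theorem compL_nil {i j : V} (x : Path i j →₀ k) :
    compL i j j x (Finsupp.single Path.nil 1) = x := by
  induction x using Finsupp.induction_linear with
  | zero => simp
  | add y y' h h' => simp [h, h']
  | single q d => simp [compL_single]

open Classical in
/-- The path `p`, as an element of the path algebra. -/
def ofPath {i j : V} (p : Path i j) : PathAlgebra k V :=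
  Pi.single i (Pi.single j (Finsupp.single p 1))

theorem add_apply (x y : PathAlgebra k V) (i j : V) : (x + y) i j = x i j + y i j := rfl

theorem smul_apply (c : k) (x : PathAlgebra k V) (i j : V) : (c • x) i j = c • x i j := rfl

theorem zero_apply (i j : V) : (0 : PathAlgebra k V) i j = 0 := rfl

open Classical in
instance : One (PathAlgebra k V) where
  one := fun i => Pi.single i (Finsupp.single Path.nil 1)

theorem one_apply_self (i : V) : (1 : PathAlgebra k V) i i = Finsupp.single Path.nil 1 := by
  classical
  exact Pi.single_eq_same (M := fun j => Path i j →₀ k) i _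

theorem one_apply_ne {i j : V} (h : j ≠ i) : (1 : PathAlgebra k V) i j = 0 := by
  classical
  exact Pi.single_eq_of_ne (M := fun j => Path i j →₀ k) h _

variable [Fintype V]

/-- Paths are composed from right to left: `x * y` is "first `y`, then `x`". -/
instance : Mul (PathAlgebra k V) where
  mul x y := fun i j => ∑ l : V, compL i l j (y i l) (x l j)

theorem mul_apply (x y : PathAlgebra k V) (i j : V) :
    (x * y) i j = ∑ l : V, compL i l j (y i l) (x l j) := rfl

instance : Ring (PathAlgebra k V) where
  left_distrib x y z := by
    funext i j; simp [mul_apply, add_apply, Finset.sum_add_distrib]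
  right_distrib x y z := by
    funext i j; simp [mul_apply, add_apply, Finset.sum_add_distrib]
  zero_mul x := by funext i j; simp [mul_apply, zero_apply]
  mul_zero x := by funext i j; simp [mul_apply, zero_apply]
  mul_assoc x y z := by
    funext i j
    simp only [mul_apply, map_sum, LinearMap.sum_apply, compL_assoc]
    exact Finset.sum_comm
  one_mul x := by
    funext i j
    rw [mul_apply, Finset.sum_eq_single j, one_apply_self, compL_nil]
    · intro l _ hl
      rw [one_apply_ne (Ne.symm hl), map_zero]
    · simp
  mul_one x := by
    funext i j
    rw [mul_apply, Finset.sum_eq_single i, one_apply_self, nil_compL]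
    · intro l _ hl
      rw [one_apply_ne hl, map_zero, LinearMap.zero_apply]
    · simp
  zsmul := fun n x => n • x
  zsmul_zero' x := zero_zsmul x
  zsmul_succ' n x := SubNegMonoid.zsmul_succ' n x
  zsmul_neg' n x := SubNegMonoid.zsmul_neg' n x
  neg_add_cancel x := neg_add_cancel x
  nsmul := fun n x => n • x
  nsmul_zero x := zero_nsmul x
  nsmul_succ n x := succ_nsmul x n
  sub_eq_add_neg x y := sub_eq_add_neg x y

instance : Algebra k (PathAlgebra k V) :=
  Algebra.ofModule
    (fun c x y => by funext i j; simp [mul_apply, smul_apply, Finset.smul_sum])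
    (fun c x y => by funext i j; simp [mul_apply, smul_apply, Finset.smul_sum])

/-- The path algebra of a wide subquiver `Q_B` of `Q_A`, as a subalgebra of the path algebra of
`Q_A`: it is generated by all vertices and the arrows of `Q_B`. -/
def ofSubquiver (k : Type*) [CommRing k] {V : Type*} [Quiver V] [Fintype V]
    (QB : WideSubquiver V) : Subalgebra k (PathAlgebra k V) :=
  Algebra.adjoin k ({x | ∃ i : V, x = ofPath (Path.nil : Path i i)} ∪
    {x | ∃ (i j : V) (a : i ⟶ j), a ∈ QB i j ∧ x = ofPath a.toPath})

/-- The square of the arrow ideal of `kQ`: the two-sided ideal generated by the paths of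
length two. -/
def arrowIdealSq (k V : Type*) [CommRing k] [Quiver V] [Fintype V] :
    TwoSidedIdeal (PathAlgebra k V) :=
  TwoSidedIdeal.span {x | ∃ (i j : V) (p : Path i j), p.length = 2 ∧ x = ofPath p}

end PathAlgebra

/-- `ν : kQ_A → A` presents `A` as the radical square zero algebra of the quiver `Q_A` (on the
vertex set `V`), and presents the subalgebra `B` as the radical square zero subalgebra of the
subquiver `Q_B`: the kernel of `ν` is generated by all paths of length two, and `B` is the image
of the path algebra of `Q_B`. -/
structure IsRadSqZeroPair {k V A : Type*} [CommRing k] [Quiver V] [Fintype V] [Ring A]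
    [Algebra k A] (ν : PathAlgebra k V →ₐ[k] A) (QB : WideSubquiver V) (B : Subalgebra k A) :
    Prop where
  surjective : Function.Surjective ν
  ker_eq : TwoSidedIdeal.ker ν = PathAlgebra.arrowIdealSq k V
  image_eq : (PathAlgebra.ofSubquiver k QB).map ν = B

end PathAlgebra

/-! ### Parallel arrows and the combinatorial complex -/

section Combinatorics

open Quiver

variable (k : Type*) [Field k] {V : Type*} [Quiver V] (QB : WideSubquiver V)

/-- The arrows of `Q_A` from `p.1` to `p.2`; this is a class of parallel arrows when non-empty. -/
abbrev Arr (p : V × V) : Type _ := p.1 ⟶ p.2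

/-- The arrows from `p.1` to `p.2` of the complement quiver `Q_C` of `Q_A` by the arrows of
`Q_B`. -/
abbrev CArr (p : V × V) : Type _ := {a : Arr p // a ∉ QB p.1 p.2}

/-- The classes `[α]` of parallel arrows of `Q_C`: a class is given by its source and target.
The class has the `|α|` elements of `CArr QB p`. -/
def classes : Set (V × V) := {p | Nonempty (CArr QB p)}

/-- `S`: the classes of `Q_C` with more than one arrow. -/
def classesS : Set (V × V) := {p | p ∈ classes QB ∧ 1 < Nat.card (CArr QB p)}

/-- The classes of `Q_C` to which no arrow of `Q_B` is parallel. -/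
def classesD : Set (V × V) := {p | p ∈ classes QB ∧ ¬ ∃ b : Arr p, b ∈ QB p.1 p.2}

/-- The classes of `Q_C` to which some arrow of `Q_B` is parallel. -/
def classesE : Set (V × V) := {p | p ∈ classes QB ∧ ∃ b : Arr p, b ∈ QB p.1 p.2}

/-- The basis `𝓑` of `kQ/J²` given by the paths of length at most one: the part from `i` to `j`. -/
abbrev BPath (i j : V) : Type _ := {p : Path i j // p.length ≤ 1}

open Classical in
/-- The class in `kQ/J²` of a path of `Q`, expressed in the basis `𝓑`. -/
def toB {i j : V} (p : Path i j) : BPath i j →₀ k :=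
  if h : p.length ≤ 1 then Finsupp.single ⟨p, h⟩ 1 else 0

/-- `k(Q₀ // 𝓑)`: the coefficient of `e_i // q` in `g` is `g i q`. -/
abbrev Cochain0 (k V : Type*) [Field k] [Quiver V] : Type _ := ∀ i : V, BPath i i →₀ k

/-- `k(Q₁ // 𝓑)`: the coefficient of `a // q` in `f` is `f p a q`, for an arrow `a` from `p.1` to
`p.2`. -/
abbrev Cochain1 (k V : Type*) [Field k] [Quiver V] : Type _ :=
  ∀ p : V × V, Arr p → (BPath p.1 p.2 →₀ k)

/-- `δ⁰(e // q) = ∑_{s(a) = e, aq ∈ 𝓑} a // aq - ∑_{t(a) = e, qa ∈ 𝓑} a // qa`. -/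
def delta0 (k V : Type*) [Field k] [Quiver V] : Cochain0 k V →ₗ[k] Cochain1 k V where
  toFun g := fun p a =>
    Finsupp.linearCombination k (fun q : BPath p.1 p.1 => toB k (q.1.comp a.toPath)) (g p.1) -
    Finsupp.linearCombination k (fun q : BPath p.2 p.2 => toB k (a.toPath.comp q.1)) (g p.2)
  map_add' g h := by
    funext p a
    simp only [Pi.add_apply, map_add]; abel
  map_smul' c g := by
    funext p a
    simp only [Pi.smul_apply, map_smul, smul_sub, RingHom.id_apply]

/-- `Im(δ⁰_{A|B})`: the elements of `Im(δ⁰_A)` whose restriction to the arrows of `Q_B` is zero. -/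
def imDelta0 : Submodule k (Cochain1 k V) where
  carrier := {f | f ∈ LinearMap.range (delta0 k V) ∧
    ∀ (p : V × V) (a : Arr p), a ∈ QB p.1 p.2 → f p a = 0}
  add_mem' := by
    rintro f g ⟨hf, hf'⟩ ⟨hg, hg'⟩
    exact ⟨add_mem hf hg, fun p a ha => by simp [hf' p a ha, hg' p a ha]⟩
  zero_mem' := ⟨zero_mem _, fun _ _ _ => rfl⟩
  smul_mem' := by
    rintro c f ⟨hf, hf'⟩
    exact ⟨Submodule.smul_mem _ c hf, fun p a ha => by simp [hf' p a ha]⟩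

end Combinatorics

/-! ### The Lie algebras in the decomposition -/

section Decomposition

set_option linter.unusedSectionVars false

open Quiver Classical

/-- A Lie algebra homomorphism `f : L → 𝔤` whose image normalizes the Lie subalgebra `N` of `𝔤`
makes `L` act on `N` by derivations, `x ↦ [f x, -]`. -/
def adAct {k L 𝔤 : Type*} [CommRing k] [LieRing L] [LieAlgebra k L] [LieRing 𝔤] [LieAlgebra k 𝔤]
    (N : LieSubalgebra k 𝔤) (f : L →ₗ⁅k⁆ 𝔤) (h : ∀ x : L, ∀ y ∈ N, ⁅f x, y⁆ ∈ N) :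
    L →ₗ⁅k⁆ LieDerivation k N N where
  toFun x :=
    { toFun := fun y => ⟨⁅f x, y.1⁆, h x y.1 y.2⟩
      map_add' := fun y z => Subtype.ext (lie_add (f x) y.1 z.1)
      map_smul' := fun c y => Subtype.ext (lie_smul c (f x) y.1)
      leibniz' := fun y z => Subtype.ext (by
        change ⁅f x, ⁅y.1, z.1⁆⁆ = ⁅y.1, ⁅f x, z.1⁆⁆ - ⁅z.1, ⁅f x, y.1⁆⁆
        rw [leibniz_lie (f x) y.1 z.1, ← lie_skew z.1 ⁅f x, y.1⁆]; abel) }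
  map_add' x y := LieDerivation.ext fun z => Subtype.ext (by
    change ⁅f (x + y), z.1⁆ = ⁅f x, z.1⁆ + ⁅f y, z.1⁆
    rw [map_add, add_lie])
  map_smul' c x := LieDerivation.ext fun z => Subtype.ext (by
    change ⁅f (c • x), z.1⁆ = c • ⁅f x, z.1⁆
    rw [map_smul, smul_lie])
  map_lie' {x y} := LieDerivation.ext fun z => by
    rw [LieDerivation.commutator_apply]
    apply Subtype.ext
    change ⁅f ⁅x, y⁆, z.1⁆ = ⁅f x, ⁅f y, z.1⁆⁆ - ⁅f y, ⁅f x, z.1⁆⁆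
    rw [LieHom.map_lie, lie_lie]

/-- If the action `φ` of `L` on `N` commutes with the action `ψ` of `H` on `N`, then `L` acts on the
semidirect sum of `N` and `H` by derivations, through `φ` on `N` and by zero on `H`. -/
def semiAct {k L N H : Type*} [CommRing k] [LieRing L] [LieAlgebra k L] [LieRing N]
    [LieAlgebra k N] [LieRing H] [LieAlgebra k H] (ψ : H →ₗ⁅k⁆ LieDerivation k N N)
    (φ : L →ₗ⁅k⁆ LieDerivation k N N) (h : ∀ (s : L) (x : H) (y : N), φ s (ψ x y) = ψ x (φ s y)) :
    L →ₗ⁅k⁆ LieDerivation k (LieAlgebra.SemiDirectSum N H ψ)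
      (LieAlgebra.SemiDirectSum N H ψ) where
  toFun s :=
    { toFun := fun r => ⟨φ s r.left, 0⟩
      map_add' := fun r r' => by ext1 <;> simp
      map_smul' := fun c r => by ext1 <;> simp
      leibniz' := fun r r' => by
        ext1
        · simp [h]; abel
        · simp }
  map_add' s t := by ext r <;> simp
  map_smul' c s := by ext r <;> simp
  map_lie' {s t} := by
    ext r
    · simp
    · simp

/-- The componentwise action by derivations on a product of Lie algebras. -/
def piAct {k L ι : Type*} {M : ι → Type*} [CommRing k] [LieRing L] [LieAlgebra k L]
    [∀ i, LieRing (M i)] [∀ i, LieAlgebra k (M i)]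
    (φ : ∀ i, L →ₗ⁅k⁆ LieDerivation k (M i) (M i)) :
    L →ₗ⁅k⁆ LieDerivation k (∀ i, M i) (∀ i, M i) where
  toFun s :=
    { toFun := fun r i => φ i s (r i)
      map_add' := fun r r' => funext fun i => map_add (φ i s) (r i) (r' i)
      map_smul' := fun c r => funext fun i => map_smul (φ i s) c (r i)
      leibniz' := fun r r' => funext fun i => (φ i s).leibniz' (r i) (r' i) }
  map_add' s t := LieDerivation.ext fun r => funext fun i => by
    change φ i (s + t) (r i) = φ i s (r i) + φ i t (r i)
    rw [map_add]; rfl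
  map_smul' c s := LieDerivation.ext fun r => funext fun i => by
    change φ i (c • s) (r i) = c • φ i s (r i)
    rw [map_smul]; rfl
  map_lie' {s t} := LieDerivation.ext fun r => funext fun i => by
    rw [LieDerivation.commutator_apply]
    change φ i ⁅s, t⁆ (r i) = φ i s (φ i t (r i)) - φ i t (φ i s (r i))
    rw [LieHom.map_lie, LieDerivation.commutator_apply]

/-- An action of `L` on `M` by derivations, extended by zero to an action on `M × P`. -/
def prodAct {k L M P : Type*} [CommRing k] [LieRing L] [LieAlgebra k L] [LieRing M]
    [LieAlgebra k M] [LieRing P] [LieAlgebra k P] (φ : L →ₗ⁅k⁆ LieDerivation k M M) :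
    L →ₗ⁅k⁆ LieDerivation k (M × P) (M × P) where
  toFun s :=
    { toFun := fun r => (φ s r.1, 0)
      map_add' := fun r r' => by simp
      map_smul' := fun c r => by simp
      leibniz' := fun r r' => Prod.ext ((φ s).leibniz' r.1 r'.1) (by
        change (0 : P) = ⁅r.2, (0 : P)⁆ - ⁅r'.2, (0 : P)⁆
        rw [lie_zero, lie_zero, sub_zero]) }
  map_add' s t := by ext r <;> simp
  map_smul' c s := by ext r <;> simp
  map_lie' {s t} := by
    ext r
    · simp
    · simp

variable (k : Type*) [Field k] {V : Type*} [Quiver V] [∀ i j : V, Fintype (i ⟶ j)]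
  (QB : WideSubquiver V)

/-- For a class `p` of parallel arrows of `Q_A`, the span of the `a // b` with `a`, `b` in the
class, with the bracket `[a // b, c // d] = δ_{d,a} c // b - δ_{b,c} a // d`.  This is the space of
square matrices with the commutator bracket, `a // b` being the matrix unit with its one in row `b`
and column `a` (the linear map `a ↦ b`). -/
abbrev ParLie (p : V × V) : Type _ := Matrix (Arr p) (Arr p) k

/-- `ℑ_α`: the span of the `a // b` with `a` an arrow of `Q_C` and `b` an arrow of `Q_B` in the
class `p`. -/
def frakI (p : V × V) : LieSubalgebra k (ParLie k p) where
  carrier := {M | ∀ b a : Arr p, (a ∈ QB p.1 p.2 ∨ b ∉ QB p.1 p.2) → M b a = 0}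
  add_mem' := by
    intro M N hM hN b a h
    rw [Matrix.add_apply, hM b a h, hN b a h, add_zero]
  zero_mem' := fun _ _ _ => rfl
  smul_mem' := by
    intro c M hM b a h
    rw [Matrix.smul_apply, hM b a h, smul_zero]
  lie_mem' := by
    intro M N hM hN b a h
    have key : ∀ M' N' : ParLie k p,
        (∀ b a : Arr p, (a ∈ QB p.1 p.2 ∨ b ∉ QB p.1 p.2) → M' b a = 0) →
        (∀ b a : Arr p, (a ∈ QB p.1 p.2 ∨ b ∉ QB p.1 p.2) → N' b a = 0) → (M' * N') b a = 0 := by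
      intro M' N' hM' hN'
      rw [Matrix.mul_apply]
      refine Finset.sum_eq_zero fun c _ => ?_
      by_cases hc : c ∈ QB p.1 p.2
      · rw [hM' b c (Or.inl hc), zero_mul]
      · rw [hN' c a (Or.inr hc), mul_zero]
    rw [Ring.lie_def, Matrix.sub_apply, key M N hM hN, key N M hN hM, sub_zero]

/-- `I_α = ∑ a // a`, the sum over the arrows `a` of `Q_C` in the class `p`. -/
def elI (p : V × V) : ParLie k p :=
  Matrix.diagonal fun a => if a ∈ QB p.1 p.2 then 0 else 1

/-- `k I_α`. -/
def lineI (p : V × V) : LieSubalgebra k (ParLie k p) where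
  toSubmodule := Submodule.span k {elI k QB p}
  lie_mem' := by
    intro M N hM hN
    obtain ⟨c, rfl⟩ := Submodule.mem_span_singleton.1 hM
    obtain ⟨d, rfl⟩ := Submodule.mem_span_singleton.1 hN
    rw [smul_lie, lie_smul, lie_self, smul_zero, smul_zero]
    exact Submodule.zero_mem _

theorem elI_lie_mem (p : V × V) (N : ParLie k p) (hN : N ∈ frakI k QB p) :
    ⁅elI k QB p, N⁆ ∈ frakI k QB p := by
  intro b a h
  rw [Ring.lie_def, Matrix.sub_apply, elI, Matrix.diagonal_mul, Matrix.mul_diagonal, hN b a h]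
  simp

theorem lineI_lie_mem (p : V × V) (x : lineI k QB p) (N : ParLie k p) (hN : N ∈ frakI k QB p) :
    ⁅(lineI k QB p).incl x, N⁆ ∈ frakI k QB p := by
  obtain ⟨x, hx⟩ := x
  obtain ⟨c, rfl⟩ := Submodule.mem_span_singleton.1 hx
  change ⁅c • elI k QB p, N⁆ ∈ frakI k QB p
  rw [smul_lie]
  exact (frakI k QB p).smul_mem c (elI_lie_mem k QB p N hN)

/-- `ℑ_α ⋊ k I_α`, where `k I_α` acts on `ℑ_α` by the bracket of `ParLie k p`. -/
abbrev IkI (p : V × V) : Type _ :=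
  LieAlgebra.SemiDirectSum (frakI k QB p) (lineI k QB p)
    (adAct (frakI k QB p) (lineI k QB p).incl (lineI_lie_mem k QB p))

/-- `∏_{[α] ∈ D} k I_α`. -/
abbrev ProdD : Type _ := ∀ p : classesD QB, lineI k QB p.1

/-- The inclusion of `∏_{[α] ∈ D} k I_α` in `k(Q₁ // 𝓑)`. -/
def prodDIncl : ProdD k QB →ₗ[k] Cochain1 k V where
  toFun x := fun p a =>
    if h : p ∈ classesD QB then ∑ b : Arr p, (x ⟨p, h⟩).1 b a • toB k b.toPath else 0
  map_add' x y := by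
    funext p a
    by_cases h : p ∈ classesD QB
    · simp [h, add_smul, Finset.sum_add_distrib]
    · simp [h]
  map_smul' c x := by
    funext p a
    by_cases h : p ∈ classesD QB
    · simp [h, mul_smul, Finset.smul_sum]
    · simp [h]

theorem lineI_lie (p : V × V) (x y : lineI k QB p) : ⁅x, y⁆ = 0 := by
  obtain ⟨x, hx⟩ := x
  obtain ⟨y, hy⟩ := y
  obtain ⟨c, rfl⟩ := Submodule.mem_span_singleton.1 hx
  obtain ⟨d, rfl⟩ := Submodule.mem_span_singleton.1 hy
  apply Subtype.ext
  change ⁅c • elI k QB p, d • elI k QB p⁆ = 0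
  rw [smul_lie, lie_smul, lie_self, smul_zero, smul_zero]

/-- `Im(δ⁰_{A|B})` as an ideal of `∏_{[α] ∈ D} k I_α`; see `imDelta0_le_range`. -/
def imIdeal : LieIdeal k (ProdD k QB) where
  toSubmodule := (imDelta0 k QB).comap (prodDIncl k QB)
  lie_mem := by
    intro x y _
    have : ⁅x, y⁆ = 0 := funext fun p => lineI_lie k QB p.1 (x p) (y p)
    rw [this]
    exact Submodule.zero_mem _

/-- `𝔞 = (∏_{[α] ∈ D} k I_α) / Im(δ⁰_{A|B})`. -/
abbrev frakA : Type _ := ProdD k QB ⧸ imIdeal k QB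

/-- The radical part `(∏_{[α] ∈ E} ℑ_α ⋊ k I_α) × 𝔞`. -/
abbrev RadPart : Type _ := (∀ p : classesE QB, IkI k QB p.1) × frakA k QB

/-- `∏_{[α] ∈ S} 𝔰𝔩_{|α|}(k)`, where `𝔰𝔩_{|α|}(k)` is realized on the arrows of `[α]`. -/
abbrev SlPart : Type _ := ∀ p : classesS QB, LieAlgebra.SpecialLinear.sl (CArr QB p.1) k

/-- Extension by zero of a matrix indexed by the arrows of `Q_C` in the class `p`: the copy of
`𝔤𝔩_{|α|}(k)` spanned by the `a // b` with `a`, `b` arrows of `Q_C`. -/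
def extC (p : V × V) (M : Matrix (CArr QB p) (CArr QB p) k) : ParLie k p :=
  Matrix.of fun b a =>
    if h : b ∉ QB p.1 p.2 ∧ a ∉ QB p.1 p.2 then M ⟨b, h.1⟩ ⟨a, h.2⟩ else 0

theorem extC_add (p : V × V) (M N : Matrix (CArr QB p) (CArr QB p) k) :
    extC k QB p (M + N) = extC k QB p M + extC k QB p N := by
  ext b a
  by_cases h : b ∉ QB p.1 p.2 ∧ a ∉ QB p.1 p.2 <;> simp [extC, h]

theorem extC_smul (p : V × V) (c : k) (M : Matrix (CArr QB p) (CArr QB p) k) :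
    extC k QB p (c • M) = c • extC k QB p M := by
  ext b a
  by_cases h : b ∉ QB p.1 p.2 ∧ a ∉ QB p.1 p.2 <;> simp [extC, h]

theorem extC_mul (p : V × V) (M N : Matrix (CArr QB p) (CArr QB p) k) :
    extC k QB p (M * N) = extC k QB p M * extC k QB p N := by
  ext b a
  rw [Matrix.mul_apply]
  by_cases hb : b ∈ QB p.1 p.2
  · simp [extC, hb]
  by_cases ha : a ∈ QB p.1 p.2
  · simp [extC, ha]
  have h1 : extC k QB p (M * N) b a = ∑ c : CArr QB p, M ⟨b, hb⟩ c * N c ⟨a, ha⟩ := by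
    simp [extC, hb, ha, Matrix.mul_apply]
  have h2 : ∀ c : CArr QB p, M ⟨b, hb⟩ c * N c ⟨a, ha⟩ =
      extC k QB p M b c.1 * extC k QB p N c.1 a := by
    intro c
    simp [extC, hb, ha, c.2]
  rw [h1, Finset.sum_congr rfl fun c _ => h2 c]
  rw [← Fintype.sum_subtype_add_sum_subtype (fun c : Arr p => c ∉ QB p.1 p.2)
    fun c => extC k QB p M b c * extC k QB p N c a]
  rw [Finset.sum_eq_zero (s := (Finset.univ : Finset {c : Arr p // ¬ c ∉ QB p.1 p.2})), add_zero]
  intro c _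
  simp [extC, not_not.1 c.2]

theorem extC_lie_mem (p : V × V) (M : Matrix (CArr QB p) (CArr QB p) k) (N : ParLie k p)
    (hN : N ∈ frakI k QB p) : ⁅extC k QB p M, N⁆ ∈ frakI k QB p := by
  intro b a h
  have h1 : (extC k QB p M * N) b a = 0 := by
    rw [Matrix.mul_apply]
    refine Finset.sum_eq_zero fun c _ => ?_
    by_cases hc : c ∈ QB p.1 p.2
    · simp [extC, hc]
    · rw [hN c a (Or.inr hc), mul_zero]
  have h2 : (N * extC k QB p M) b a = 0 := by
    rw [Matrix.mul_apply]
    refine Finset.sum_eq_zero fun c _ => ?_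
    rcases h with h | h
    · simp [extC, h]
    · rw [hN b c (Or.inr h), zero_mul]
  rw [Ring.lie_def, Matrix.sub_apply, h1, h2, sub_zero]

theorem extC_lie_elI (p : V × V) (M : Matrix (CArr QB p) (CArr QB p) k) :
    ⁅extC k QB p M, elI k QB p⁆ = 0 := by
  ext b a
  rw [Ring.lie_def, Matrix.sub_apply, elI, Matrix.diagonal_mul, Matrix.mul_diagonal]
  by_cases hb : b ∈ QB p.1 p.2
  · simp [extC, hb]
  by_cases ha : a ∈ QB p.1 p.2
  · simp [extC, ha]
  simp [ha, hb]

/-- The component at the class `p` of an element of `∏_{[α] ∈ S} 𝔰𝔩_{|α|}(k)`, as an element of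
`ParLie k p` (zero if `p` is not in `S`). -/
def slAt (p : V × V) : SlPart k QB →ₗ⁅k⁆ ParLie k p where
  toFun s := if h : p ∈ classesS QB then extC k QB p (s ⟨p, h⟩).1 else 0
  map_add' s t := by
    by_cases h : p ∈ classesS QB
    · simp only [h, dite_true]
      exact extC_add k QB p _ _
    · simp [h]
  map_smul' c s := by
    by_cases h : p ∈ classesS QB
    · simp only [h, dite_true]
      exact extC_smul k QB p c _
    · simp [h]
  map_lie' {s t} := by
    by_cases h : p ∈ classesS QB
    · simp only [h, dite_true]
      rw [pi_lie_apply, LieAlgebra.SpecialLinear.sl_bracket, Ring.lie_def, ← extC_mul, ← extC_mul,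
        eq_sub_iff_add_eq, ← extC_add, sub_add_cancel]
    · simp [h]

theorem slAt_lie_mem (p : V × V) (s : SlPart k QB) (N : ParLie k p) (hN : N ∈ frakI k QB p) :
    ⁅slAt k QB p s, N⁆ ∈ frakI k QB p := by
  change ⁅(if h : p ∈ classesS QB then extC k QB p (s ⟨p, h⟩).1 else 0 : ParLie k p), N⁆ ∈ _
  split_ifs with h
  · exact extC_lie_mem k QB p _ N hN
  · rw [zero_lie]
    exact zero_mem _

theorem slAt_lie_lineI (p : V × V) (s : SlPart k QB) (x : lineI k QB p) :
    ⁅slAt k QB p s, x.1⁆ = 0 := by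
  obtain ⟨x, hx⟩ := x
  obtain ⟨c, rfl⟩ := Submodule.mem_span_singleton.1 hx
  change ⁅(if h : p ∈ classesS QB then extC k QB p (s ⟨p, h⟩).1 else 0 : ParLie k p),
    c • elI k QB p⁆ = 0
  split_ifs with h
  · rw [lie_smul, extC_lie_elI, smul_zero]
  · rw [zero_lie]

/-- The action of `∏_{[α] ∈ S} 𝔰𝔩_{|α|}(k)` on `ℑ_p` by the bracket of `ParLie k p`. -/
def slActI (p : V × V) : SlPart k QB →ₗ⁅k⁆ LieDerivation k (frakI k QB p) (frakI k QB p) :=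
  adAct (frakI k QB p) (slAt k QB p) (slAt_lie_mem k QB p)

theorem slActI_comm (p : V × V) (s : SlPart k QB) (x : lineI k QB p) (N : frakI k QB p) :
    slActI k QB p s (adAct (frakI k QB p) (lineI k QB p).incl (lineI_lie_mem k QB p) x N) =
    adAct (frakI k QB p) (lineI k QB p).incl (lineI_lie_mem k QB p) x (slActI k QB p s N) := by
  apply Subtype.ext
  change ⁅slAt k QB p s, ⁅x.1, N.1⁆⁆ = ⁅x.1, ⁅slAt k QB p s, N.1⁆⁆
  rw [leibniz_lie, slAt_lie_lineI, zero_lie, zero_add]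

/-- The action of `∏_{[α] ∈ S} 𝔰𝔩_{|α|}(k)` on `(∏_{[α] ∈ E} ℑ_α ⋊ k I_α) × 𝔞` by derivations: it
acts on each `ℑ_α` by the bracket of `ParLie`, and by zero on each `k I_α` and on `𝔞` (the
matrices in `𝔰𝔩_{|α|}(k)` commute with `I_α`). -/
def slAct : SlPart k QB →ₗ⁅k⁆ LieDerivation k (RadPart k QB) (RadPart k QB) :=
  prodAct (piAct fun p : classesE QB => semiAct _ (slActI k QB p.1) (slActI_comm k QB p.1))

/-- `∏_{[α] ∈ S} 𝔰𝔩_{|α|}(k) ⋉ ((∏_{[α] ∈ E} ℑ_α ⋊ k I_α) × 𝔞)`. -/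
abbrev Decomp : Type _ :=
  LieAlgebra.SemiDirectSum (RadPart k QB) (SlPart k QB) (slAct k QB)

theorem linearCombination_left {p : V × V} (a : Arr p) (g : BPath p.1 p.1 →₀ k) :
    Finsupp.linearCombination k (fun q : BPath p.1 p.1 => toB k (q.1.comp a.toPath)) g =
      g ⟨Path.nil, by simp⟩ • toB k a.toPath := by
  induction g using Finsupp.induction_linear with
  | zero => simp
  | add x y hx hy => rw [map_add, hx, hy, Finsupp.add_apply, add_smul]
  | single q c =>
    obtain ⟨q, hq⟩ := q
    rw [Finsupp.linearCombination_single]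
    by_cases h0 : q.length = 0
    · obtain rfl := Path.eq_nil_of_length_zero q h0
      simp [Hom.toPath]
    · have h1 : toB k (q.comp a.toPath) = 0 := by
        simp [toB, h0]
      have h2 : (⟨q, hq⟩ : BPath p.1 p.1) ≠ ⟨Path.nil, by simp⟩ := by
        rintro h
        have h' : q = Path.nil := congrArg Subtype.val h
        exact h0 (by rw [h']; rfl)
      rw [h1, Finsupp.single_eq_of_ne (Ne.symm h2), smul_zero, zero_smul]

theorem linearCombination_right {p : V × V} (a : Arr p) (g : BPath p.2 p.2 →₀ k) :
    Finsupp.linearCombination k (fun q : BPath p.2 p.2 => toB k (a.toPath.comp q.1)) g =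
      g ⟨Path.nil, by simp⟩ • toB k a.toPath := by
  induction g using Finsupp.induction_linear with
  | zero => simp
  | add x y hx hy => rw [map_add, hx, hy, Finsupp.add_apply, add_smul]
  | single q c =>
    obtain ⟨q, hq⟩ := q
    rw [Finsupp.linearCombination_single]
    by_cases h0 : q.length = 0
    · obtain rfl := Path.eq_nil_of_length_zero q h0
      simp
    · have h1 : toB k (a.toPath.comp q) = 0 := by
        simp [toB, Path.length_comp, Path.length_toPath, h0]
      have h2 : (⟨q, hq⟩ : BPath p.2 p.2) ≠ ⟨Path.nil, by simp⟩ := by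
        rintro h
        have h' : q = Path.nil := congrArg Subtype.val h
        exact h0 (by rw [h']; rfl)
      rw [h1, Finsupp.single_eq_of_ne (Ne.symm h2), smul_zero, zero_smul]

/-- `Im(δ⁰_{A|B})` is contained in `∏_{[α] ∈ D} k I_α`. -/
theorem imDelta0_le_range : imDelta0 k QB ≤ LinearMap.range (prodDIncl k QB) := by
  rintro f ⟨⟨g, rfl⟩, hf⟩
  let c : V × V → k := fun p => g p.1 ⟨Path.nil, by simp⟩ - g p.2 ⟨Path.nil, by simp⟩
  have hg : ∀ (p : V × V) (a : Arr p), delta0 k V g p a = c p • toB k a.toPath := by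
    intro p a
    simp only [delta0, LinearMap.coe_mk, AddHom.coe_mk]
    rw [linearCombination_left, linearCombination_right, ← sub_smul]
  refine ⟨fun p => ⟨c p.1 • elI k QB p.1, Submodule.mem_span_singleton.2 ⟨_, rfl⟩⟩, ?_⟩
  funext p a
  rw [hg]
  change (if h : p ∈ classesD QB then
    ∑ b : Arr p, (c p • elI k QB p) b a • toB k b.toPath else 0) = _
  split_ifs with h
  · have ha : a ∉ QB p.1 p.2 := fun ha => h.2 ⟨a, ha⟩
    rw [Finset.sum_eq_single a]
    · simp [elI, ha]
    · intro b _ hb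
      simp [elI, Matrix.diagonal_apply_ne _ hb]
    · simp
  · symm
    by_cases ha : a ∈ QB p.1 p.2
    · rw [← hg, hf p a ha]
    · have : ∃ b : Arr p, b ∈ QB p.1 p.2 := by
        by_contra hb
        exact h ⟨⟨⟨a, ha⟩⟩, hb⟩
      obtain ⟨b, hb⟩ := this
      have h1 := hf p b hb
      rw [hg] at h1
      have h2 : c p = 0 := by
        have := congrArg (fun z => z ⟨b.toPath, by simp⟩) h1
        simpa [toB] using this
      rw [h2, zero_smul]

end Decomposition

end RelHH

/-! A derivation that is $B$-linear on both sides kills $B$, in particular the vertices. It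
therefore sends an arrow $a\colon i\to j$ into $e_jAe_i$, which is spanned by the arrows parallel to
$a$ and, for a loop, by $e_i$. The coefficient of $e_i$ vanishes: applying the derivation to $a^2=0$
gives twice that coefficient times $a$. A relative derivation is thus a family of square matrices,
one for each pair of vertices, whose columns at arrows of $Q_B$ are zero (`map_arrow`). Every such
family occurs (`derOf_mul`, `derOf_mem_relDer`), because products of arrows are zero, and brackets
become matrix commutators (`mat_lie`).

In one parallel class the surviving columns split into a block with rows in $Q_B$, which is
$\mathfrak I_\alpha$, and a block with rows in $Q_C$, which is $\mathfrak{gl}_{|\alpha|}$. Products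
within $\mathfrak I_\alpha$ vanish and $\mathfrak{gl}_{|\alpha|}$ acts on it by commutators. In
characteristic $0$ the normalized trace splits $\mathfrak{gl}_{|\alpha|}$ as
$kI_\alpha\times\mathfrak{sl}_{|\alpha|}$. This is the bracket computation `toDecomp_lie`, with
surjectivity in `exists_toDecomp_eq`.

The inner derivation $[x,-]$ multiplies each arrow by the difference of the vertex coefficients of
$x$ at its endpoints (`mem_relInn_iff`). Being zero on $Q_B$, it is zero on every class in
$\overline E$, so only the factors $kI_\alpha$ with $[\alpha]\in\overline D$ are affected, and there
the inner derivations are exactly $\mathrm{Im}(\delta^0_{A|B})$ (`mem_imIdeal_iff`,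
`toDecomp_eq_zero_iff`). The first isomorphism theorem concludes. -/

namespace RelHH

attribute [local instance] LieRing.ofAssociativeRing

open Quiver

/-! ### The path algebra modulo the square of the arrow ideal -/

namespace PathAlgebra

variable {k V : Type*} [CommRing k] [Quiver V]

/-- Length is additive under concatenation. This is what makes `longIdeal` closed under
multiplication on both sides. -/
theorem compL_mem_supported {i l j : V} (n : ℕ) (x : Path i l →₀ k) (y : Path l j →₀ k)
    (h : ∀ p ∈ x.support, ∀ q ∈ y.support, n ≤ p.length + q.length) :
    compL i l j x y ∈ Finsupp.supported k k {r : Path i j | n ≤ r.length} := by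
  classical
  rw [compL, Finsupp.linearCombination_apply, Finsupp.sum, LinearMap.sum_apply]
  refine Submodule.sum_mem _ fun p hp => ?_
  rw [LinearMap.smul_apply]
  refine Submodule.smul_mem _ _ ?_
  rw [Finsupp.mem_supported]
  intro r hr
  rw [Finsupp.lmapDomain_apply] at hr
  obtain ⟨q, hq, rfl⟩ := Finset.mem_image.1 (Finsupp.mapDomain_support hr)
  simpa [Path.length_comp] using h p hp q hq

open Classical in
/-- The inclusion of the component of the path algebra spanned by the paths `i → j`. -/
def component (i j : V) : (Path i j →₀ k) →ₗ[k] PathAlgebra k V :=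
  (LinearMap.single k (fun i : V => ∀ j : V, Path i j →₀ k) i) ∘ₗ
    (LinearMap.single k (fun j : V => Path i j →₀ k) j)

theorem component_single {i j : V} (p : Path i j) (c : k) :
    component i j (Finsupp.single p c) = c • (ofPath p : PathAlgebra k V) := by
  classical
  have : Finsupp.single p c = c • Finsupp.single p (1 : k) := by simp
  rw [this, map_smul]
  rfl

theorem component_apply_self (i j : V) (z : Path i j →₀ k) : component i j z i j = z := by
  classical
  change (Pi.single i (Pi.single j z) : ∀ i j : V, Path i j →₀ k) i j = z
  simp

theorem component_apply_ne_left {i j i' j' : V} (z : Path i j →₀ k) (h : i' ≠ i) :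
    component i j z i' j' = 0 := by
  classical
  change (Pi.single i (Pi.single j z) : ∀ i j : V, Path i j →₀ k) i' j' = 0
  simp [Pi.single_eq_of_ne h]

theorem component_apply_ne_right {i j j' : V} (z : Path i j →₀ k) (h : j' ≠ j) :
    component i j z i j' = 0 := by
  classical
  change (Pi.single i (Pi.single j z) : ∀ i j : V, Path i j →₀ k) i j' = 0
  simp [Pi.single_eq_of_ne h]

theorem ofPath_eq_component {i j : V} (p : Path i j) :
    (ofPath p : PathAlgebra k V) = component i j (Finsupp.single p 1) := by
  rw [component_single, one_smul]

/-- The coefficients of the paths of length at most one in an element of the path algebra. -/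
def lowCoeff (k V : Type*) [CommRing k] [Quiver V] :
    PathAlgebra k V →ₗ[k] (V ⊕ (Σ p : V × V, Arr p)) → k where
  toFun x := Sum.elim (fun i => x i i Path.nil) (fun a => x a.1.1 a.1.2 a.2.toPath)
  map_add' x y := by ext (i | a) <;> rfl
  map_smul' c x := by ext (i | a) <;> rfl

open Classical in
theorem lowCoeff_vertex (i : V) :
    lowCoeff k V (ofPath (Path.nil : Path i i)) = Pi.single (Sum.inl i) 1 := by
  rw [ofPath_eq_component]
  ext (j | ⟨⟨i', j'⟩, a⟩)
  · change component i i (Finsupp.single Path.nil 1) j j Path.nil = _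
    by_cases h : j = i
    · subst h
      simp [component_apply_self]
    · rw [component_apply_ne_left _ h, Pi.single_eq_of_ne (by simpa using h)]
      rfl
  · change component i i (Finsupp.single Path.nil 1) i' j' a.toPath = _
    rw [Pi.single_eq_of_ne (by simp)]
    by_cases h : i' = i
    · subst h
      by_cases h' : j' = i'
      · subst h'
        rw [component_apply_self, Finsupp.single_eq_of_ne]
        intro h
        simpa using congrArg Path.length h
      · rw [component_apply_ne_right _ h']
        rfl
    · rw [component_apply_ne_left _ h]
      rfl

open Classical in
theorem lowCoeff_arrow (p : V × V) (a : Arr p) :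
    lowCoeff k V (ofPath a.toPath) = Pi.single (Sum.inr ⟨p, a⟩) 1 := by
  obtain ⟨i, j⟩ := p
  rw [ofPath_eq_component]
  ext (l | ⟨⟨i', j'⟩, b⟩)
  · change component i j (Finsupp.single a.toPath 1) l l Path.nil = _
    rw [Pi.single_eq_of_ne (by simp)]
    by_cases h : l = i
    · subst h
      by_cases h' : l = j
      · subst h'
        rw [component_apply_self, Finsupp.single_eq_of_ne]
        intro h
        simpa using congrArg Path.length h
      · rw [component_apply_ne_right _ h']
        rfl
    · rw [component_apply_ne_left _ h]
      rfl
  · change component i j (Finsupp.single a.toPath 1) i' j' b.toPath = _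
    by_cases h : i' = i
    · subst h
      by_cases h' : j' = j
      · subst h'
        rw [component_apply_self]
        by_cases hab : b = a
        · subst hab
          simp
        · rw [Finsupp.single_eq_of_ne, Pi.single_eq_of_ne]
          · simpa using hab
          · exact fun h => hab (eq_of_heq (Path.hom_heq_of_cons_eq_cons h))
      · rw [component_apply_ne_right _ h', Pi.single_eq_of_ne]
        · rfl
        · simp +contextual [h']
    · rw [component_apply_ne_left _ h, Pi.single_eq_of_ne]
      · rfl
      · simp [h]

variable [Fintype V]

theorem sum_component (x : PathAlgebra k V) : ∑ i, ∑ j, component i j (x i j) = x := by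
  classical
  have h : ∀ i, ∑ j, component i j (x i j) =
      (LinearMap.single k (fun i : V => ∀ j : V, Path i j →₀ k) i (x i)) := by
    intro i
    rw [← Finset.univ_sum_single (x i), map_sum]
    refine Finset.sum_congr rfl fun j _ => ?_
    rw [Finset.univ_sum_single]
    rfl
  rw [Finset.sum_congr rfl fun i _ => h i]
  exact Finset.univ_sum_single x

theorem ofPath_mul_ofPath {i l j : V} (p : Path i l) (q : Path l j) :
    (ofPath q * ofPath p : PathAlgebra k V) = ofPath (p.comp q) := by
  simp only [ofPath_eq_component]
  funext i' j'
  rw [mul_apply]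
  by_cases hi : i' = i
  · subst hi
    rw [Finset.sum_eq_single l]
    · by_cases hj : j' = j
      · subst hj
        simp only [component_apply_self, compL_single, mul_one]
      · rw [component_apply_ne_right _ hj, component_apply_ne_right _ hj, map_zero]
    · intro m _ hm
      rw [component_apply_ne_right _ hm, map_zero, LinearMap.zero_apply]
    · simp
  · rw [component_apply_ne_left _ hi]
    refine Finset.sum_eq_zero fun m _ => ?_
    rw [component_apply_ne_left _ hi, map_zero, LinearMap.zero_apply]

theorem ofPath_mul_ofPath_of_ne {i l l' j : V} (p : Path i l) (q : Path l' j) (h : l ≠ l') :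
    (ofPath q * ofPath p : PathAlgebra k V) = 0 := by
  simp only [ofPath_eq_component]
  funext i' j'
  rw [mul_apply, zero_apply]
  refine Finset.sum_eq_zero fun m _ => ?_
  by_cases hm : m = l'
  · subst hm
    by_cases hi : i' = i
    · subst hi
      rw [component_apply_ne_right _ (Ne.symm h), map_zero, LinearMap.zero_apply]
    · rw [component_apply_ne_left _ hi, map_zero, LinearMap.zero_apply]
  · rw [component_apply_ne_left _ hm, map_zero]

/-- The two-sided ideal of the combinations of paths of length at least `n`. -/
def longIdeal (k V : Type*) [CommRing k] [Quiver V] [Fintype V] (n : ℕ) :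
    TwoSidedIdeal (PathAlgebra k V) :=
  TwoSidedIdeal.mk' {x | ∀ i j : V, x i j ∈ Finsupp.supported k k {r : Path i j | n ≤ r.length}}
    (fun i j => Submodule.zero_mem _)
    (fun hx hy i j => Submodule.add_mem _ (hx i j) (hy i j))
    (fun hx i j => Submodule.neg_mem _ (hx i j))
    (fun {x y} hy i j => by
      rw [mul_apply]
      refine Submodule.sum_mem _ fun l _ => compL_mem_supported n _ _ fun p hp q _ => ?_
      exact le_add_right ((Finsupp.mem_supported _ _).1 (hy i l) hp))
    (fun {x y} hx i j => by
      rw [mul_apply]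
      refine Submodule.sum_mem _ fun l _ => compL_mem_supported n _ _ fun p _ q hq => ?_
      exact le_add_left ((Finsupp.mem_supported _ _).1 (hx l j) hq))

theorem mem_longIdeal {n : ℕ} {x : PathAlgebra k V} : x ∈ longIdeal k V n ↔
    ∀ i j : V, x i j ∈ Finsupp.supported k k {r : Path i j | n ≤ r.length} :=
  TwoSidedIdeal.mem_mk' ..

theorem arrowIdealSq_le_longIdeal : arrowIdealSq k V ≤ longIdeal k V 2 := by
  rw [arrowIdealSq, TwoSidedIdeal.span_le]
  rintro _ ⟨i, j, p, hp, rfl⟩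
  rw [SetLike.mem_coe, mem_longIdeal]
  intro i' j'
  rw [ofPath_eq_component]
  by_cases hi : i' = i
  · subst hi
    by_cases hj : j' = j
    · subst hj
      rw [component_apply_self]
      exact Finsupp.single_mem_supported k 1 hp.ge
    · rw [component_apply_ne_right _ hj]
      exact Submodule.zero_mem _
  · rw [component_apply_ne_left _ hi]
    exact Submodule.zero_mem _

theorem ofPath_mem_arrowIdealSq {i j : V} (p : Path i j) (hp : 2 ≤ p.length) :
    ofPath p ∈ arrowIdealSq k V := by
  rcases p with _ | ⟨p, b⟩
  · simp at hp
  rcases p with _ | ⟨p, a⟩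
  · simp at hp
  -- Splitting off the last two arrows exhibits the path as a multiple of a generator.
  have h : (p.cons a).cons b = p.comp (a.toPath.comp b.toPath) := rfl
  rw [h, ← ofPath_mul_ofPath]
  refine TwoSidedIdeal.mul_mem_right _ _ _ (TwoSidedIdeal.subset_span ⟨_, _, _, ?_, rfl⟩)
  rfl

/-- This replaces an ideal given by generators with a condition on supports, which can be tested on
coefficients. -/
theorem longIdeal_two : longIdeal k V 2 = arrowIdealSq k V := by
  refine le_antisymm (fun x hx => ?_) arrowIdealSq_le_longIdeal
  rw [mem_longIdeal] at hx
  rw [← sum_component x]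
  refine sum_mem fun i _ => sum_mem fun j _ => ?_
  rw [← Finsupp.sum_single (x i j), Finsupp.sum, map_sum]
  refine sum_mem fun p hp => ?_
  -- A scalar multiple is a left multiple by an element of the algebra, so the ideal absorbs it.
  rw [component_single, Algebra.smul_def]
  exact TwoSidedIdeal.mul_mem_left _ _ _
    (ofPath_mem_arrowIdealSq p ((Finsupp.mem_supported _ _).1 (hx i j) hp))

/-- With `ker_eq`, this gives `lowCoeff` and the presentation `ν` the same kernel, so the
coefficients on paths of length at most one become coordinates on $A$. -/
theorem lowCoeff_eq_zero_iff {x : PathAlgebra k V} :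
    lowCoeff k V x = 0 ↔ x ∈ arrowIdealSq k V := by
  rw [← longIdeal_two, mem_longIdeal]
  constructor
  · intro h i j
    rw [Finsupp.mem_supported']
    intro p hp
    rcases p with _ | ⟨p, a⟩
    · exact congrFun h (Sum.inl i)
    rcases p with _ | ⟨p, a⟩
    · exact congrFun h (Sum.inr ⟨(i, j), a⟩)
    · exact absurd (by simp : 2 ≤ ((p.cons a).cons _).length) hp
  · intro h
    ext (i | ⟨⟨i, j⟩, a⟩)
    · exact (Finsupp.mem_supported' _ _).1 (h i i) _ (by simp)
    · exact (Finsupp.mem_supported' _ _).1 (h i j) _ (by simp [Path.length_toPath])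

theorem lowCoeff_surjective [∀ i j : V, Finite (i ⟶ j)] :
    Function.Surjective (lowCoeff k V) := by
  classical
  have := fun i j : V => Fintype.ofFinite (i ⟶ j)
  rw [← LinearMap.range_eq_top, eq_top_iff, ← (Pi.basisFun k _).span_eq, Submodule.span_le]
  rintro _ ⟨i | ⟨p, a⟩, rfl⟩
  · exact ⟨_, by rw [lowCoeff_vertex, Pi.basisFun_apply]⟩
  · exact ⟨_, by rw [lowCoeff_arrow, Pi.basisFun_apply]⟩

end PathAlgebra

/-! ### The basis of vertices and arrows -/

open Classical in
/-- A basis of `A` consisting of the vertices and the arrows of the quiver `V`, multiplied as in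
the radical square zero algebra of `V`. -/
structure ArrowBasis (k V A : Type*) [CommRing k] [Quiver V] [Ring A] [Algebra k A] where
  basis : Module.Basis (V ⊕ (Σ p : V × V, Arr p)) k A
  vert_mul_vert : ∀ i j : V, basis (.inl i) * basis (.inl j) = if i = j then basis (.inl j) else 0
  vert_mul_arrow : ∀ (i : V) (p : V × V) (a : Arr p),
    basis (.inl i) * basis (.inr ⟨p, a⟩) = if i = p.2 then basis (.inr ⟨p, a⟩) else 0
  arrow_mul_vert : ∀ (i : V) (p : V × V) (a : Arr p),
    basis (.inr ⟨p, a⟩) * basis (.inl i) = if i = p.1 then basis (.inr ⟨p, a⟩) else 0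
  arrow_mul_arrow : ∀ a b : (Σ p : V × V, Arr p), basis (.inr a) * basis (.inr b) = 0

theorem IsRadSqZeroPair.exists_arrowBasis {k V A : Type*} [CommRing k] [Quiver V] [Fintype V]
    [∀ i j : V, Finite (i ⟶ j)] [Ring A] [Algebra k A] {ν : PathAlgebra k V →ₐ[k] A}
    {QB : WideSubquiver V} {B : Subalgebra k A} (hν : IsRadSqZeroPair ν QB B) :
    ∃ β : ArrowBasis k V A, B = Algebra.adjoin k (Set.range (fun i => β.basis (.inl i)) ∪
      {x | ∃ (p : V × V) (a : Arr p), a ∈ QB p.1 p.2 ∧ x = β.basis (.inr ⟨p, a⟩)}) := by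
  classical
  have := fun i j : V => Fintype.ofFinite (i ⟶ j)
  have hker : LinearMap.ker ν.toLinearMap = LinearMap.ker (PathAlgebra.lowCoeff k V) := by
    ext x
    rw [LinearMap.mem_ker, LinearMap.mem_ker, PathAlgebra.lowCoeff_eq_zero_iff, ← hν.ker_eq]
    exact (TwoSidedIdeal.mem_ker ν).symm
  -- Both $A$ and the coordinate space are quotients of $kQ_A$ by the same kernel.
  let e : A ≃ₗ[k] ((V ⊕ (Σ p : V × V, Arr p)) → k) :=
    (LinearMap.quotKerEquivOfSurjective ν.toLinearMap hν.surjective).symm ≪≫ₗ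
      Submodule.quotEquivOfEq _ _ hker ≪≫ₗ
      LinearMap.quotKerEquivOfSurjective _ PathAlgebra.lowCoeff_surjective
  have he : ∀ x, e (ν x) = PathAlgebra.lowCoeff k V x := by
    intro x
    have h : (LinearMap.quotKerEquivOfSurjective ν.toLinearMap hν.surjective).symm (ν x) =
        Submodule.Quotient.mk x := by
      rw [LinearEquiv.symm_apply_eq]
      rfl
    simp only [e, LinearEquiv.trans_apply, h]
    rfl
  let b := Module.Basis.ofEquivFun e
  have hb : ∀ x i, PathAlgebra.lowCoeff k V x = Pi.single i 1 → b i = ν x := by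
    intro x i h
    rw [Module.Basis.coe_ofEquivFun, LinearEquiv.symm_apply_eq, he, h]
  have hv : ∀ i, b (.inl i) = ν (PathAlgebra.ofPath (Path.nil : Path i i)) :=
    fun i => hb _ _ (PathAlgebra.lowCoeff_vertex i)
  have ha : ∀ p (a : Arr p), b (.inr ⟨p, a⟩) = ν (PathAlgebra.ofPath a.toPath) :=
    fun p a => hb _ _ (PathAlgebra.lowCoeff_arrow p a)
  refine ⟨⟨b, fun i j => ?_, fun i p a => ?_, fun i p a => ?_, ?_⟩, ?_⟩
  · split_ifs with h
    · subst h
      rw [hv, ← map_mul, PathAlgebra.ofPath_mul_ofPath, Path.comp_nil]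
    · rw [hv, hv, ← map_mul, PathAlgebra.ofPath_mul_ofPath_of_ne _ _ (Ne.symm h), map_zero]
  · split_ifs with h
    · subst h
      rw [hv, ha, ← map_mul, PathAlgebra.ofPath_mul_ofPath, Path.comp_nil]
    · rw [hv, ha, ← map_mul, PathAlgebra.ofPath_mul_ofPath_of_ne _ _ (Ne.symm h), map_zero]
  · split_ifs with h
    · subst h
      rw [hv, ha, ← map_mul, PathAlgebra.ofPath_mul_ofPath, Path.nil_comp]
    · rw [hv, ha, ← map_mul, PathAlgebra.ofPath_mul_ofPath_of_ne _ _ h, map_zero]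
  · rintro ⟨⟨i, j⟩, a⟩ ⟨⟨i', j'⟩, a'⟩
    rw [ha, ha, ← map_mul]
    by_cases h : j' = i
    · subst h
      rw [PathAlgebra.ofPath_mul_ofPath, ← TwoSidedIdeal.mem_ker, hν.ker_eq]
      exact PathAlgebra.ofPath_mem_arrowIdealSq _ le_rfl
    · rw [PathAlgebra.ofPath_mul_ofPath_of_ne _ _ h, map_zero]
  · refine hν.image_eq.symm.trans ?_
    rw [PathAlgebra.ofSubquiver, AlgHom.map_adjoin, Set.image_union]
    congr 2
    · ext x
      constructor
      · rintro ⟨_, ⟨i, rfl⟩, rfl⟩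
        exact ⟨i, hv i⟩
      · rintro ⟨i, rfl⟩
        exact ⟨_, ⟨i, rfl⟩, (hv i).symm⟩
    · ext x
      constructor
      · rintro ⟨_, ⟨i, j, a, h, rfl⟩, rfl⟩
        exact ⟨(i, j), a, h, (ha (i, j) a).symm⟩
      · rintro ⟨p, a, h, rfl⟩
        exact ⟨_, ⟨p.1, p.2, a, h, rfl⟩, (ha p a).symm⟩

/-! ### Relative derivations as families of matrices -/

namespace ArrowBasis

open Classical

variable {k V A : Type*} [Quiver V]

variable [Field k] [Ring A] [Algebra k A] (β : ArrowBasis k V A)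

/-- The basis element of a vertex. -/
def vert (i : V) : A := β.basis (.inl i)

/-- The basis element of an arrow. -/
def arrow (p : V × V) (a : Arr p) : A := β.basis (.inr ⟨p, a⟩)

theorem vert_mul (i j : V) : β.vert i * β.vert j = if i = j then β.vert j else 0 :=
  β.vert_mul_vert i j

theorem vert_mul_arr (i : V) (p : V × V) (a : Arr p) :
    β.vert i * β.arrow p a = if i = p.2 then β.arrow p a else 0 := β.vert_mul_arrow i p a

theorem arr_mul_vert (i : V) (p : V × V) (a : Arr p) :
    β.arrow p a * β.vert i = if i = p.1 then β.arrow p a else 0 := β.arrow_mul_vert i p a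

theorem arr_mul_arr (p q : V × V) (a : Arr p) (b : Arr q) :
    β.arrow p a * β.arrow q b = 0 := β.arrow_mul_arrow ⟨p, a⟩ ⟨q, b⟩

theorem linearMap_ext {N : Type*} [AddCommGroup N] [Module k N] {f g : A →ₗ[k] N}
    (hv : ∀ i, f (β.vert i) = g (β.vert i)) (ha : ∀ p a, f (β.arrow p a) = g (β.arrow p a)) :
    f = g :=
  β.basis.ext (by rintro (i | ⟨p, a⟩); exacts [hv i, ha p a])

/-- The coefficient of a vertex. -/
def vCoeff (i : V) : A →ₗ[k] k := β.basis.coord (.inl i)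

/-- The coefficient of an arrow. -/
def aCoeff (p : V × V) (a : Arr p) : A →ₗ[k] k := β.basis.coord (.inr ⟨p, a⟩)

theorem aCoeff_arrow (p : V × V) (a b : Arr p) :
    β.aCoeff p b (β.arrow p a) = if b = a then 1 else 0 := by
  simp [aCoeff, arrow, Finsupp.single_apply, eq_comm]

/-- The matrix by which a linear map acts on the arrows of a parallel class. -/
def mat (p : V × V) : Module.End k A →ₗ[k] Matrix (Arr p) (Arr p) k where
  toFun f := Matrix.of fun b a => β.aCoeff p b (f (β.arrow p a))
  map_add' f g := by ext; simp
  map_smul' c f := by ext; simp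

theorem mat_apply (p : V × V) (f : Module.End k A) (b a : Arr p) :
    β.mat p f b a = β.aCoeff p b (f (β.arrow p a)) := rfl

/-- The subalgebra generated by the vertices and the arrows of a subquiver. -/
def subalgebra (QB : WideSubquiver V) : Subalgebra k A :=
  Algebra.adjoin k (Set.range β.vert ∪
    {x | ∃ (p : V × V) (a : Arr p), a ∈ QB p.1 p.2 ∧ x = β.arrow p a})

section

variable {β} {QB : WideSubquiver V}

theorem vert_mem_subalgebra (i : V) : β.vert i ∈ β.subalgebra QB :=
  Algebra.subset_adjoin (Or.inl ⟨i, rfl⟩)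

theorem arrow_mem_subalgebra {p : V × V} {a : Arr p} (ha : a ∈ QB p.1 p.2) :
    β.arrow p a ∈ β.subalgebra QB :=
  Algebra.subset_adjoin (Or.inr ⟨p, a, ha, rfl⟩)

/-- The Leibniz rule gives $f(1)=0$, and left linearity gives $f(b)=b\,f(1)$. -/
theorem map_eq_zero_of_mem_relDer {A : Type*} [Ring A] [Algebra k A] {B : Subalgebra k A}
    {f : Module.End k A} (hf : f ∈ relDer k B) {b : A} (hb : b ∈ B) : f b = 0 := by
  have h1 : f 1 = 0 := by simpa using hf.1 1 1
  simpa [h1] using hf.2.1 b hb 1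

/-- The kernel of a derivation is a subalgebra, so vanishing on generators gives vanishing on $B$;
the Leibniz rule then turns this into bilinearity over $B$. -/
theorem mem_relDer_of_map_eq_zero {f : Module.End k A}
    (hf : ∀ x y : A, f (x * y) = x * f y + f x * y) (hv : ∀ i, f (β.vert i) = 0)
    (ha : ∀ (p : V × V) (a : Arr p), a ∈ QB p.1 p.2 → f (β.arrow p a) = 0) :
    f ∈ relDer k (β.subalgebra QB) := by
  have h1 : f 1 = 0 := by simpa using hf 1 1
  have h : ∀ b ∈ β.subalgebra QB, f b = 0 := by
    intro b hb
    induction hb using Algebra.adjoin_induction with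
    | mem x hx =>
      obtain ⟨i, rfl⟩ | ⟨p, a, h, rfl⟩ := hx
      exacts [hv i, ha p a h]
    | algebraMap r => rw [Algebra.algebraMap_eq_smul_one, map_smul, h1, smul_zero]
    | add x y _ _ hx hy => rw [map_add, hx, hy, add_zero]
    | mul x y _ _ hx hy => rw [hf, hx, hy, mul_zero, zero_mul, add_zero]
  exact ⟨hf, fun b hb x => by rw [hf, h b hb, zero_mul, add_zero],
    fun b hb x => by rw [hf, h b hb, mul_zero, zero_add]⟩

theorem mat_apply_of_mem {f : Module.End k A} (hf : f ∈ relDer k (β.subalgebra QB)) (p : V × V)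
    (b a : Arr p) (ha : a ∈ QB p.1 p.2) : β.mat p f b a = 0 := by
  rw [mat_apply, map_eq_zero_of_mem_relDer hf (arrow_mem_subalgebra ha), map_zero]

end

variable [∀ i j : V, Fintype (i ⟶ j)]

section Fintype

variable [Fintype V]

theorem sum_coeff (x : A) :
    ∑ i, β.vCoeff i x • β.vert i + ∑ p, ∑ a, β.aCoeff p a x • β.arrow p a = x := by
  conv_rhs => rw [← β.basis.sum_repr x, Fintype.sum_sum_type, Fintype.sum_sigma]
  rfl

/-- The Peirce component $e_jAe_i$ in coordinates: the vertex contributes only when $i=j$. -/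
theorem vert_mul_mul_vert (p : V × V) (x : A) :
    β.vert p.2 * x * β.vert p.1 = (if p.2 = p.1 then β.vCoeff p.1 x • β.vert p.1 else 0) +
      ∑ a, β.aCoeff p a x • β.arrow p a := by
  conv_lhs => rw [← β.sum_coeff x]
  simp only [mul_add, add_mul, Finset.mul_sum, Finset.sum_mul, mul_smul_comm, smul_mul_assoc,
    vert_mul, vert_mul_arr, ite_mul, zero_mul, arr_mul_vert]
  congr 1
  · rw [Finset.sum_eq_single p.2]
    · rw [if_pos rfl]
      split_ifs with h
      · rw [h]
      · simp
    · intro i _ hi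
      rw [if_neg (Ne.symm hi), smul_zero]
    · simp
  · rw [Finset.sum_eq_single p]
    · simp
    · intro q _ hq
      refine Finset.sum_eq_zero fun a _ => ?_
      by_cases h2 : p.2 = q.2
      · by_cases h1 : p.1 = q.1
        · exact absurd (Prod.ext h1 h2).symm hq
        · simp [h1]
      · simp [h2]
    · simp

end Fintype

/-- The linear map that kills the vertices and acts on the arrows of each parallel class by a
matrix. -/
def derOf (M : ∀ p : V × V, ParLie k p) : Module.End k A :=
  β.basis.constr k (Sum.elim 0 fun a => ∑ b, M a.1 b a.2 • β.arrow a.1 b)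

theorem derOf_vert (M : ∀ p : V × V, ParLie k p) (i : V) : β.derOf M (β.vert i) = 0 := by
  simp [derOf, vert]

theorem derOf_arrow (M : ∀ p : V × V, ParLie k p) (p : V × V) (a : Arr p) :
    β.derOf M (β.arrow p a) = ∑ b, M p b a • β.arrow p b := by
  rw [derOf, arrow, Module.Basis.constr_basis]
  rfl


theorem derOf_mul (M : ∀ p : V × V, ParLie k p) (x y : A) :
    β.derOf M (x * y) = x * β.derOf M y + β.derOf M x * y := by
  -- As an identity of bilinear maps, the Leibniz rule need only be checked on pairs of basis
  -- elements. With a vertex it holds because parallel arrows have the same endpoints; for two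
  -- arrows all terms vanish.
  have h : (LinearMap.mul k A).compr₂ (β.derOf M) =
      (LinearMap.mul k A).compl₂ (β.derOf M) + (LinearMap.mul k A).comp (β.derOf M) := by
    refine β.linearMap_ext (fun i => β.linearMap_ext (fun j => ?_) fun q b => ?_)
      fun p a => β.linearMap_ext (fun j => ?_) fun q b => ?_
    · simp only [LinearMap.compr₂_apply, LinearMap.mul_apply', LinearMap.add_apply,
        LinearMap.compl₂_apply, LinearMap.comp_apply, derOf_vert, vert_mul]
      split_ifs <;> simp [derOf_vert]
    · simp only [LinearMap.compr₂_apply, LinearMap.mul_apply', LinearMap.add_apply,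
        LinearMap.compl₂_apply, LinearMap.comp_apply, derOf_vert, vert_mul_arr, derOf_arrow,
        Finset.mul_sum, mul_smul_comm]
      split_ifs <;> simp [derOf_arrow]
    · simp only [LinearMap.compr₂_apply, LinearMap.mul_apply', LinearMap.add_apply,
        LinearMap.compl₂_apply, LinearMap.comp_apply, derOf_vert, arr_mul_vert, derOf_arrow,
        Finset.sum_mul, smul_mul_assoc]
      split_ifs <;> simp [derOf_arrow]
    · simp only [LinearMap.compr₂_apply, LinearMap.mul_apply', LinearMap.add_apply,
        LinearMap.compl₂_apply, LinearMap.comp_apply, arr_mul_arr, derOf_arrow, Finset.mul_sum,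
        Finset.sum_mul, smul_mul_assoc, mul_smul_comm]
      simp
  exact LinearMap.congr_fun (LinearMap.congr_fun h x) y

variable {β} {QB : WideSubquiver V}

theorem derOf_mem_relDer {M : ∀ p : V × V, ParLie k p}
    (hM : ∀ (p : V × V) (b a : Arr p), a ∈ QB p.1 p.2 → M p b a = 0) :
    β.derOf M ∈ relDer k (β.subalgebra QB) :=
  mem_relDer_of_map_eq_zero (β.derOf_mul M) (β.derOf_vert M) fun p a ha => by
    simp [derOf_arrow, hM p _ a ha]

theorem mat_derOf (M : ∀ p : V × V, ParLie k p) (p : V × V) : β.mat p (β.derOf M) = M p := by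
  ext b a
  simp [mat_apply, derOf_arrow, aCoeff_arrow]

variable [Fintype V] [CharZero k]

/-- Linearity over the vertices confines the image to one Peirce component; only a vertex term at a
loop remains to be excluded. -/
theorem map_arrow {f : Module.End k A} (hf : f ∈ relDer k (β.subalgebra QB)) (p : V × V)
    (a : Arr p) : f (β.arrow p a) = ∑ b, β.mat p f b a • β.arrow p b := by
  have h1 : f (β.arrow p a) = β.vert p.2 * f (β.arrow p a) * β.vert p.1 := by
    rw [← hf.2.1 _ (vert_mem_subalgebra _), ← hf.2.2 _ (vert_mem_subalgebra _), vert_mul_arr,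
      if_pos rfl, arr_mul_vert, if_pos rfl]
  rw [vert_mul_mul_vert] at h1
  by_cases hp : p.2 = p.1
  · rw [if_pos hp] at h1
    -- If $f(a)=ce+\cdots$ at a loop $a$, then $0=f(a^2)=a f(a)+f(a)a=2ca$. Here characteristic $2$
    -- must be excluded.
    have h2 := hf.1 (β.arrow p a) (β.arrow p a)
    rw [arr_mul_arr, map_zero, h1] at h2
    have h3 : (2 * β.vCoeff p.1 (f (β.arrow p a))) • β.arrow p a = 0 := by
      rw [two_mul, add_smul]
      simpa [mul_add, add_mul, arr_mul_vert, vert_mul_arr, arr_mul_arr, Finset.mul_sum,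
        Finset.sum_mul, hp] using h2.symm
    have h4 : β.arrow p a ≠ 0 := β.basis.ne_zero _
    have h5 : β.vCoeff p.1 (f (β.arrow p a)) = 0 := by simpa [h4] using h3
    rw [h5, zero_smul, zero_add] at h1
    exact h1
  · rw [if_neg hp, zero_add] at h1
    exact h1

/-- Only the map applied first has to keep the span of a parallel class stable. -/
theorem mat_mul {f : Module.End k A} (g : Module.End k A) (hg : g ∈ relDer k (β.subalgebra QB))
    (p : V × V) : β.mat p (f * g) = β.mat p f * β.mat p g := by
  ext b a
  rw [Matrix.mul_apply, mat_apply, Module.End.mul_apply, map_arrow hg]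
  simp [mat_apply, mul_comm]

theorem mat_lie {f g : Module.End k A} (hf : f ∈ relDer k (β.subalgebra QB))
    (hg : g ∈ relDer k (β.subalgebra QB)) (p : V × V) :
    β.mat p ⁅f, g⁆ = ⁅β.mat p f, β.mat p g⁆ := by
  rw [Ring.lie_def, Ring.lie_def, map_sub, mat_mul g hg, mat_mul f hf]

theorem mem_relInn_iff {f : relDer k (β.subalgebra QB)} :
    f ∈ relInn k (β.subalgebra QB) ↔
      ∃ g : V → k, ∀ p, β.mat p f.1 = (g p.1 - g p.2) • (1 : ParLie k p) := by
  constructor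
  · rintro ⟨x, hx⟩
    -- On arrows $[x,-]$ gives target minus source coefficient; the sign matches the source minus
    -- target convention of `delta0`.
    refine ⟨fun i => -β.vCoeff i x, fun p => ?_⟩
    have h : ∀ a, f.1 (β.arrow p a) = (β.vCoeff p.2 x - β.vCoeff p.1 x) • β.arrow p a := by
      intro a
      rw [hx]
      conv_lhs => rw [← β.sum_coeff x]
      simp [mul_add, add_mul, Finset.sum_mul, Finset.mul_sum, vert_mul_arr, arr_mul_vert,
        arr_mul_arr, sub_smul]
    ext b a
    rw [mat_apply, h, map_smul, aCoeff_arrow, Matrix.smul_apply, Matrix.one_apply]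
    simp [neg_add_eq_sub]
  · rintro ⟨g, hg⟩
    refine ⟨-∑ i, g i • β.vert i, fun y => ?_⟩
    have h : f.1 = LinearMap.mulLeft k (-∑ i, g i • β.vert i) -
        LinearMap.mulRight k (-∑ i, g i • β.vert i) := by
      refine β.linearMap_ext (fun i => ?_) fun p a => ?_
      · rw [map_eq_zero_of_mem_relDer f.2 (vert_mem_subalgebra i)]
        simp [Finset.sum_mul, Finset.mul_sum, vert_mul]
      · rw [map_arrow f.2, hg]
        simp [Finset.sum_mul, Finset.mul_sum, vert_mul_arr, arr_mul_vert, Matrix.one_apply,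
          sub_smul]
        abel
    rw [h]
    rfl


end ArrowBasis

open Classical

/-! ### Block decomposition of the matrices of one parallel class -/

section Matrices

set_option linter.unusedSectionVars false

variable (k : Type*) [Field k] {V : Type*} [Quiver V] (QB : WideSubquiver V) (p : V × V)

theorem extC_apply (X : Matrix (CArr QB p) (CArr QB p) k) (b a : CArr QB p) :
    extC k QB p X b.1 a.1 = X b a := by
  simp [extC, b.2, a.2]

variable [∀ i j : V, Fintype (i ⟶ j)]

/-- The block of a matrix in the rows and columns of the arrows of `Q_C`. -/
def resC : ParLie k p →ₗ[k] Matrix (CArr QB p) (CArr QB p) k where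
  toFun M := M.submatrix Subtype.val Subtype.val
  map_add' _ _ := rfl
  map_smul' _ _ := rfl

/-- The block of a matrix in the rows of the arrows of `Q_B` and the columns of the arrows of
`Q_C`, extended by zero. -/
def resI : ParLie k p →ₗ[k] frakI k QB p where
  toFun M := ⟨Matrix.of fun b a => if a ∈ QB p.1 p.2 ∨ b ∉ QB p.1 p.2 then 0 else M b a,
    fun b a h => by simp only [Matrix.of_apply, if_pos h]⟩
  map_add' M N := Subtype.ext (Matrix.ext fun b a => by
    change (if a ∈ QB p.1 p.2 ∨ b ∉ QB p.1 p.2 then 0 else M b a + N b a) =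
      (if a ∈ QB p.1 p.2 ∨ b ∉ QB p.1 p.2 then 0 else M b a) +
        (if a ∈ QB p.1 p.2 ∨ b ∉ QB p.1 p.2 then 0 else N b a)
    split_ifs <;> simp)
  map_smul' c M := Subtype.ext (Matrix.ext fun b a => by
    change (if a ∈ QB p.1 p.2 ∨ b ∉ QB p.1 p.2 then 0 else c * M b a) =
      c * (if a ∈ QB p.1 p.2 ∨ b ∉ QB p.1 p.2 then 0 else M b a)
    split_ifs <;> simp)

theorem resI_apply (M : ParLie k p) (b a : Arr p) : (resI k QB p M).1 b a =
    if a ∈ QB p.1 p.2 ∨ b ∉ QB p.1 p.2 then 0 else M b a := rfl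

variable {k QB p}

theorem resI_add_extC {M : ParLie k p} (hM : ∀ b a : Arr p, a ∈ QB p.1 p.2 → M b a = 0) :
    (resI k QB p M).1 + extC k QB p (resC k QB p M) = M := by
  ext b a
  rw [Matrix.add_apply, resI_apply]
  by_cases ha : a ∈ QB p.1 p.2
  · simp [ha, extC, hM]
  · by_cases hb : b ∈ QB p.1 p.2
    · simp [ha, hb, extC]
    · rw [if_pos (Or.inr hb), zero_add]
      exact extC_apply k QB p _ ⟨b, hb⟩ ⟨a, ha⟩

theorem resC_extC (X : Matrix (CArr QB p) (CArr QB p) k) :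
    resC k QB p (extC k QB p X) = X := by
  ext b a
  exact extC_apply k QB p X b a

theorem resC_frakI {N : ParLie k p} (hN : N ∈ frakI k QB p) : resC k QB p N = 0 := by
  ext b a
  exact hN b.1 a.1 (Or.inr b.2)

theorem resI_extC (X : Matrix (CArr QB p) (CArr QB p) k) :
    resI k QB p (extC k QB p X) = 0 := by
  ext b a
  rw [resI_apply]
  split_ifs with h
  · rfl
  · simp only [not_or, not_not] at h
    simp [extC, h.2]

theorem resI_frakI (N : frakI k QB p) : resI k QB p N.1 = N := by
  ext b a
  rw [resI_apply]
  split_ifs with h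
  · exact (N.2 b a h).symm
  · rfl

/-- Elements of $\mathfrak I_\alpha$ take values in the span of the $Q_B$ arrows, which they all
kill, so even their products are zero. -/
theorem frakI_lie (N N' : frakI k QB p) : ⁅N, N'⁆ = 0 := by
  have key : ∀ M M' : frakI k QB p, M.1 * M'.1 = 0 := by
    intro M M'
    ext b a
    rw [Matrix.mul_apply]
    refine Finset.sum_eq_zero fun c _ => ?_
    by_cases hc : c ∈ QB p.1 p.2
    · rw [M.2 b c (Or.inl hc), zero_mul]
    · rw [M'.2 c a (Or.inr hc), mul_zero]
  apply Subtype.ext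
  change N.1 * N'.1 - N'.1 * N.1 = 0
  rw [key, key, sub_zero]

theorem extC_one : extC k QB p 1 = elI k QB p := by
  ext b a
  by_cases hb : b ∈ QB p.1 p.2 <;> by_cases ha : a ∈ QB p.1 p.2 <;>
    simp [extC, elI, ha, hb, Matrix.one_apply, Matrix.diagonal_apply]
  · rintro rfl
    exact absurd ha hb

theorem extC_lie (X Y : Matrix (CArr QB p) (CArr QB p) k) :
    extC k QB p ⁅X, Y⁆ = ⁅extC k QB p X, extC k QB p Y⁆ := by
  rw [Ring.lie_def, Ring.lie_def, ← extC_mul, ← extC_mul, eq_sub_iff_add_eq, ← extC_add,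
    sub_add_cancel]

theorem lie_add_extC (N N' : frakI k QB p) (X X' : Matrix (CArr QB p) (CArr QB p) k) :
    ⁅N.1 + extC k QB p X, N'.1 + extC k QB p X'⁆ =
      (⁅extC k QB p X, N'.1⁆ - ⁅extC k QB p X', N.1⁆) + extC k QB p ⁅X, X'⁆ := by
  have h : ⁅N.1, N'.1⁆ = 0 := congrArg Subtype.val (frakI_lie N N')
  rw [add_lie, lie_add, lie_add, h, extC_lie, ← lie_skew (extC k QB p X') N.1]
  abel

theorem frakI_add_lineI_add_extC_apply (N : frakI k QB p) (l : lineI k QB p)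
    (X : Matrix (CArr QB p) (CArr QB p) k) (b a : Arr p) (ha : a ∈ QB p.1 p.2) :
    (N.1 + l.1 + extC k QB p X) b a = 0 := by
  obtain ⟨l, hl⟩ := l
  obtain ⟨c, rfl⟩ := Submodule.mem_span_singleton.1 hl
  rw [Matrix.add_apply, Matrix.add_apply, N.2 b a (Or.inl ha)]
  simp only [Matrix.smul_apply, elI, Matrix.diagonal_apply]
  split_ifs with h
  · simp [extC, ha]
  · simp_all
  · simp [extC, ha]

variable (k QB p)

/-- The normalized trace of the block of a matrix in the arrows of `Q_C`. -/
def meanC : ParLie k p →ₗ[k] k :=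
  (Nat.card (CArr QB p) : k)⁻¹ • (Matrix.traceLinearMap (CArr QB p) k k ∘ₗ resC k QB p)

theorem meanC_apply (M : ParLie k p) :
    meanC k QB p M = (Nat.card (CArr QB p) : k)⁻¹ * (resC k QB p M).trace := rfl

/-- The projection of a matrix to `k I_α`. -/
def lineC : ParLie k p →ₗ[k] lineI k QB p where
  toFun M := ⟨meanC k QB p M • elI k QB p, Submodule.mem_span_singleton.2 ⟨_, rfl⟩⟩
  map_add' M N := Subtype.ext (by
    change meanC k QB p (M + N) • elI k QB p =
      meanC k QB p M • elI k QB p + meanC k QB p N • elI k QB p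
    rw [map_add, add_smul])
  map_smul' c M := Subtype.ext (by
    change meanC k QB p (c • M) • elI k QB p = c • meanC k QB p M • elI k QB p
    rw [map_smul, smul_assoc])

theorem coe_lineC (M : ParLie k p) : (lineC k QB p M).1 = meanC k QB p M • elI k QB p := rfl

variable [CharZero k]

/-- The projection of a matrix to `𝔰𝔩_{|α|}(k)`. -/
def slC : ParLie k p →ₗ[k] LieAlgebra.SpecialLinear.sl (CArr QB p) k where
  toFun M := ⟨resC k QB p M - meanC k QB p M • 1, by
    refine LinearMap.mem_ker.2 ?_
    rw [Matrix.traceLinearMap_apply, Matrix.trace_sub, Matrix.trace_smul, Matrix.trace_one,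
      meanC_apply, Nat.card_eq_fintype_card]
    -- Without arrows of $Q_C$ the trace is an empty sum; otherwise $|\alpha|$ is invertible in $k$.
    by_cases h : IsEmpty (CArr QB p)
    · simp [Matrix.trace]
    · have h1 : (Fintype.card (CArr QB p) : k) ≠ 0 := by
        rw [not_isEmpty_iff] at h
        exact_mod_cast Fintype.card_ne_zero
      rw [smul_eq_mul, mul_right_comm, inv_mul_cancel₀ h1, one_mul, sub_self]⟩
  map_add' M N := Subtype.ext (by
    change resC k QB p (M + N) - meanC k QB p (M + N) • 1 =
      (resC k QB p M - meanC k QB p M • 1) + (resC k QB p N - meanC k QB p N • 1)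
    rw [map_add, map_add, add_smul]
    abel)
  map_smul' c M := Subtype.ext (by
    change resC k QB p (c • M) - meanC k QB p (c • M) • 1 =
      c • (resC k QB p M - meanC k QB p M • 1)
    rw [map_smul, map_smul, smul_sub, smul_assoc])

theorem coe_slC (M : ParLie k p) :
    (slC k QB p M).1 = resC k QB p M - meanC k QB p M • 1 := rfl

variable {k QB p}

theorem extC_resC (M : ParLie k p) :
    extC k QB p (resC k QB p M) = (lineC k QB p M).1 + extC k QB p (slC k QB p M).1 := by
  rw [coe_lineC, ← extC_one, ← extC_smul, ← extC_add, coe_slC, add_sub_cancel]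

/-- A matrix of size at most one equals its normalized trace times the identity. Hence nothing is
lost by indexing the $\mathfrak{sl}$ factors by $S$ alone. -/
theorem slC_eq_zero (hp : p ∉ classesS QB) (M : ParLie k p) : slC k QB p M = 0 := by
  have h : Subsingleton (CArr QB p) := by
    rw [← Finite.card_le_one_iff_subsingleton]
    by_contra h
    rw [not_le] at h
    exact hp ⟨(Nat.card_pos_iff.1 (by omega)).1, h⟩
  apply Subtype.ext
  ext b a
  -- Having an entry to compare rules out the empty class.
  have hc : Fintype.card (CArr QB p) = 1 := Fintype.card_eq_one_iff.2 ⟨a, fun c => h.elim _ _⟩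
  obtain rfl := h.elim a b
  rw [coe_slC, Matrix.sub_apply, Matrix.smul_apply, meanC_apply, Matrix.trace,
    Fintype.sum_eq_single a fun c hc => absurd (h.elim c a) hc]
  simp [hc]

theorem slAt_slC (M : ∀ p : V × V, ParLie k p) :
    slAt k QB p (fun q => slC k QB q.1 (M q.1)) = extC k QB p (slC k QB p (M p)).1 := by
  change (if h : p ∈ classesS QB then _ else 0) = _
  split_ifs with h
  · rfl
  · rw [slC_eq_zero h]
    ext b a
    simp [extC]

theorem meanC_eq {M : ParLie k p} (hp : p ∈ classes QB) {c : k}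
    {s : LieAlgebra.SpecialLinear.sl (CArr QB p) k} (h : resC k QB p M = c • 1 + s.1) :
    meanC k QB p M = c := by
  have hs : s.1.trace = 0 := LinearMap.mem_ker.1 s.2
  have h1 : (Fintype.card (CArr QB p) : k) ≠ 0 := by
    have : Nonempty (CArr QB p) := hp
    exact_mod_cast Fintype.card_ne_zero
  rw [meanC_apply, h, Matrix.trace_add, hs, add_zero, Matrix.trace_smul, Matrix.trace_one,
    Nat.card_eq_fintype_card, smul_eq_mul]
  field_simp

theorem slC_eq {M : ParLie k p} (hp : p ∈ classes QB) {c : k}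
    {s : LieAlgebra.SpecialLinear.sl (CArr QB p) k} (h : resC k QB p M = c • 1 + s.1) :
    slC k QB p M = s := by
  apply Subtype.ext
  rw [coe_slC, meanC_eq hp h, h, add_sub_cancel_left]

/-- Uniqueness of the three components; `eq_sum_components` is their existence. -/
theorem components_eq (hp : p ∈ classes QB) (N : frakI k QB p) (l : lineI k QB p)
    (t : LieAlgebra.SpecialLinear.sl (CArr QB p) k) :
    resI k QB p (N.1 + l.1 + extC k QB p t.1) = N ∧
      lineC k QB p (N.1 + l.1 + extC k QB p t.1) = l ∧
      slC k QB p (N.1 + l.1 + extC k QB p t.1) = t := by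
  obtain ⟨l, hl⟩ := l
  obtain ⟨c, rfl⟩ := Submodule.mem_span_singleton.1 hl
  have h1 : N.1 + c • elI k QB p + extC k QB p t.1 = N.1 + extC k QB p (c • 1 + t.1) := by
    rw [extC_add, extC_smul, extC_one, add_assoc]
  have h2 : resC k QB p (N.1 + extC k QB p (c • 1 + t.1)) = c • 1 + t.1 := by
    rw [map_add, resC_frakI N.2, resC_extC, zero_add]
  dsimp only
  rw [h1]
  refine ⟨?_, Subtype.ext ?_, slC_eq hp h2⟩
  · rw [map_add, resI_frakI, resI_extC, add_zero]
  · rw [coe_lineC, meanC_eq hp h2]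

theorem eq_sum_components {M : ParLie k p}
    (hM : ∀ b a : Arr p, a ∈ QB p.1 p.2 → M b a = 0) :
    M = (resI k QB p M).1 + (lineC k QB p M).1 + extC k QB p (slC k QB p M).1 := by
  rw [add_assoc, ← extC_resC, resI_add_extC hM]

end Matrices

/-! ### Coboundaries as differences of vertex potentials -/

section Coboundaries

theorem smul_toB_injective {k : Type*} [Field k] {V : Type*} [Quiver V] {p : V × V}
    (a : Arr p) :
    Function.Injective fun c : k => c • toB k a.toPath := by
  intro c d h
  have := congrArg (fun z => z ⟨a.toPath, by simp⟩) h
  simpa [toB] using this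

variable {k : Type*} [Field k] {V : Type*} [Quiver V] [∀ i j : V, Fintype (i ⟶ j)]
  {QB : WideSubquiver V}

theorem delta0_apply (g : Cochain0 k V) (p : V × V) (a : Arr p) :
    delta0 k V g p a =
      (g p.1 ⟨Path.nil, by simp⟩ - g p.2 ⟨Path.nil, by simp⟩) • toB k a.toPath := by
  rw [sub_smul, ← linearCombination_left, ← linearCombination_right]
  rfl

theorem prodDIncl_apply_of_mem {x : ProdD k QB} {p : V × V} (h : p ∈ classesD QB) {c : k}
    (hx : (x ⟨p, h⟩).1 = c • elI k QB p) (a : Arr p) :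
    prodDIncl k QB x p a = c • toB k a.toPath := by
  have ha : a ∉ QB p.1 p.2 := fun ha => h.2 ⟨a, ha⟩
  simp only [prodDIncl, LinearMap.coe_mk, AddHom.coe_mk, dif_pos h, hx]
  rw [Finset.sum_eq_single a]
  · simp [elI, ha]
  · intro b _ hb
    simp [elI, Matrix.diagonal_apply_ne _ hb]
  · simp

theorem prodDIncl_apply_of_notMem (x : ProdD k QB) {p : V × V} (h : p ∉ classesD QB)
    (a : Arr p) : prodDIncl k QB x p a = 0 := by
  simp only [prodDIncl, LinearMap.coe_mk, AddHom.coe_mk, dif_neg h]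

/-- Longer paths die in $J^2$, so $\delta^0$ sees only the coefficients of trivial paths and
multiplies each arrow by their difference. Membership becomes solvability for a function on
vertices. Vanishing on $Q_B$ is automatic, since `prodDIncl` is zero off $\overline D$. -/
theorem mem_imIdeal_iff {x : ProdD k QB} {c : V × V → k}
    (hx : ∀ p : classesD QB, (x p).1 = c p.1 • elI k QB p.1) :
    x ∈ imIdeal k QB ↔ ∃ g : V → k, ∀ p : V × V, Nonempty (Arr p) →
      g p.1 - g p.2 = if p ∈ classesD QB then c p else 0 := by
  constructor
  · rintro ⟨⟨g, hg⟩, -⟩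
    refine ⟨fun i => g i ⟨Path.nil, by simp⟩, fun p ⟨a⟩ => smul_toB_injective a ?_⟩
    have h := congrFun (congrFun hg p) a
    rw [delta0_apply] at h
    refine h.trans ?_
    split_ifs with hp
    · exact prodDIncl_apply_of_mem hp (hx ⟨p, hp⟩) a
    · exact (prodDIncl_apply_of_notMem x hp a).trans (zero_smul _ _).symm
  · rintro ⟨g, hg⟩
    refine ⟨⟨fun i => Finsupp.single ⟨Path.nil, by simp⟩ (g i), ?_⟩, fun p a ha =>
      prodDIncl_apply_of_notMem x (fun h => h.2 ⟨a, ha⟩) a⟩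
    funext p a
    rw [delta0_apply, Finsupp.single_eq_same, Finsupp.single_eq_same, hg p ⟨a⟩]
    split_ifs with hp
    · exact (prodDIncl_apply_of_mem hp (hx ⟨p, hp⟩) a).symm
    · rw [prodDIncl_apply_of_notMem x hp a, zero_smul]

theorem prodD_lie (x y : ProdD k QB) : ⁅x, y⁆ = 0 :=
  funext fun p => lineI_lie k QB p.1 (x p) (y p)

theorem frakA_isLieAbelian : IsLieAbelian (frakA k QB) where
  trivial x y := by
    obtain ⟨x, rfl⟩ := LieSubmodule.Quotient.surjective_mk' _ x
    obtain ⟨y, rfl⟩ := LieSubmodule.Quotient.surjective_mk' _ y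
    change ⁅(LieSubmodule.Quotient.mk x : frakA k QB), LieSubmodule.Quotient.mk y⁆ = 0
    rw [← LieSubmodule.Quotient.mk_bracket, prodD_lie]
    rfl

end Coboundaries

/-! ### The projection onto the decomposition: brackets, kernel, surjectivity -/

section ToDecomp

variable (k : Type*) [Field k] [CharZero k] {V : Type*} [Quiver V]
  [∀ i j : V, Fintype (i ⟶ j)] (QB : WideSubquiver V)

/-- The projection of a family of matrices to the decomposition. -/
def toDecomp : (∀ p : V × V, ParLie k p) →ₗ[k] Decomp k QB where
  toFun M := ⟨(fun p => ⟨resI k QB p.1 (M p.1), lineC k QB p.1 (M p.1)⟩,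
    LieSubmodule.Quotient.mk fun p => lineC k QB p.1 (M p.1)), fun p => slC k QB p.1 (M p.1)⟩
  map_add' M N := by
    refine LieAlgebra.SemiDirectSum.ext (Prod.ext (funext fun p =>
      LieAlgebra.SemiDirectSum.ext ?_ ?_) ?_) (funext fun p => ?_)
    · exact map_add (resI k QB p.1) _ _
    · exact map_add (lineC k QB p.1) _ _
    · exact congrArg LieSubmodule.Quotient.mk (funext fun p => map_add (lineC k QB p.1) _ _)
    · exact map_add (slC k QB p.1) _ _
  map_smul' c M := by
    refine LieAlgebra.SemiDirectSum.ext (Prod.ext (funext fun p =>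
      LieAlgebra.SemiDirectSum.ext ?_ ?_) ?_) (funext fun p => ?_)
    · exact map_smul (resI k QB p.1) _ _
    · exact map_smul (lineC k QB p.1) _ _
    · exact congrArg LieSubmodule.Quotient.mk (funext fun p => map_smul (lineC k QB p.1) _ _)
    · exact map_smul (slC k QB p.1) _ _

variable {k QB}

/-- With zero $Q_B$ columns, each matrix is an element of $\mathfrak I_\alpha$ plus a
$\mathfrak{gl}_{|\alpha|}$ block, and the bracket is that of a semidirect sum with abelian ideal
$\mathfrak I_\alpha$. -/
theorem toDecomp_lie {M M' : ∀ p : V × V, ParLie k p}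
    (hM : ∀ (p : V × V) (b a : Arr p), a ∈ QB p.1 p.2 → M p b a = 0)
    (hM' : ∀ (p : V × V) (b a : Arr p), a ∈ QB p.1 p.2 → M' p b a = 0) :
    toDecomp k QB (fun p => ⁅M p, M' p⁆) = ⁅toDecomp k QB M, toDecomp k QB M'⁆ := by
  have key : ∀ p, ⁅M p, M' p⁆ = (⁅extC k QB p (resC k QB p (M p)), (resI k QB p (M' p)).1⁆ -
      ⁅extC k QB p (resC k QB p (M' p)), (resI k QB p (M p)).1⁆) +
      extC k QB p ⁅resC k QB p (M p), resC k QB p (M' p)⁆ := by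
    intro p
    rw [← lie_add_extC, resI_add_extC (hM p), resI_add_extC (hM' p)]
  have hI : ∀ p, ⁅extC k QB p (resC k QB p (M p)), (resI k QB p (M' p)).1⁆ -
      ⁅extC k QB p (resC k QB p (M' p)), (resI k QB p (M p)).1⁆ ∈ frakI k QB p := fun p =>
    sub_mem (extC_lie_mem k QB p _ _ (resI k QB p (M' p)).2)
      (extC_lie_mem k QB p _ _ (resI k QB p (M p)).2)
  have hC : ∀ p, resC k QB p ⁅M p, M' p⁆ = ⁅resC k QB p (M p), resC k QB p (M' p)⁆ := by
    intro p
    rw [key, map_add, resC_frakI (hI p), resC_extC, zero_add]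
  -- Commutators have trace zero, so brackets have no component along $I_\alpha$.
  have hm : ∀ p, meanC k QB p ⁅M p, M' p⁆ = 0 := by
    intro p
    rw [meanC_apply, hC, Ring.lie_def, Matrix.trace_sub, Matrix.trace_mul_comm, sub_self,
      mul_zero]
  have hl : ∀ p, lineC k QB p ⁅M p, M' p⁆ = 0 := by
    intro p
    apply Subtype.ext
    rw [coe_lineC, hm, zero_smul]
    rfl
  refine LieAlgebra.SemiDirectSum.ext (Prod.ext (funext fun p =>
      LieAlgebra.SemiDirectSum.ext (Subtype.ext ?_) ?_) ?_) (funext fun p => ?_)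
  · obtain ⟨p, hp⟩ := p
    change (resI k QB p ⁅M p, M' p⁆).1 =
      ⁅(resI k QB p (M p)).1, (resI k QB p (M' p)).1⁆ +
        ⁅(lineC k QB p (M p)).1, (resI k QB p (M' p)).1⁆ -
        ⁅(lineC k QB p (M' p)).1, (resI k QB p (M p)).1⁆ +
        ⁅slAt k QB p (fun q => slC k QB q.1 (M q.1)), (resI k QB p (M' p)).1⁆ -
        ⁅slAt k QB p (fun q => slC k QB q.1 (M' q.1)), (resI k QB p (M p)).1⁆
    have h0 : ⁅(resI k QB p (M p)).1, (resI k QB p (M' p)).1⁆ = 0 :=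
      congrArg Subtype.val (frakI_lie (resI k QB p (M p)) (resI k QB p (M' p)))
    rw [key, map_add, resI_extC, add_zero, resI_frakI ⟨_, hI p⟩, slAt_slC, slAt_slC, h0]
    change ⁅_, _⁆ - ⁅_, _⁆ = _
    -- The action of the $\mathfrak{gl}_{|\alpha|}$ block splits into those of $kI_\alpha$ and
    -- $\mathfrak{sl}_{|\alpha|}$, which are the two nested actions of the semidirect sums.
    rw [extC_resC, extC_resC, add_lie, add_lie]
    abel
  · obtain ⟨p, hp⟩ := p
    change lineC k QB p ⁅M p, M' p⁆ = ⁅lineC k QB p (M p), lineC k QB p (M' p)⁆ + 0 - 0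
    rw [hl, lineI_lie, add_zero, sub_zero]
  · change LieSubmodule.Quotient.mk _ =
      ⁅(LieSubmodule.Quotient.mk _ : frakA k QB), LieSubmodule.Quotient.mk _⁆ + 0 - 0
    rw [← LieSubmodule.Quotient.mk_bracket, prodD_lie, funext fun p : classesD QB => hl p.1]
    exact ((sub_zero _).trans (add_zero _)).symm
  · obtain ⟨p, hp⟩ := p
    apply Subtype.ext
    change resC k QB p ⁅M p, M' p⁆ - meanC k QB p ⁅M p, M' p⁆ • 1 =
      ⁅resC k QB p (M p) - meanC k QB p (M p) • (1 : Matrix (CArr QB p) (CArr QB p) k),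
        resC k QB p (M' p) - meanC k QB p (M' p) • (1 : Matrix (CArr QB p) (CArr QB p) k)⁆
    rw [hm, hC, zero_smul, sub_zero]
    simp only [Ring.lie_def, mul_sub, sub_mul, mul_smul_comm, smul_mul_assoc, mul_one, one_mul,
      smul_sub]
    rw [smul_comm (meanC k QB p (M' p)) (meanC k QB p (M p))]
    abel

/-- The right-hand side is the description of inner derivations in `mem_relInn_iff`, so this
identifies the kernel. -/
theorem toDecomp_eq_zero_iff {M : ∀ p : V × V, ParLie k p}
    (hM : ∀ (p : V × V) (b a : Arr p), a ∈ QB p.1 p.2 → M p b a = 0) :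
    toDecomp k QB M = 0 ↔ ∃ g : V → k, ∀ p, M p = (g p.1 - g p.2) • (1 : ParLie k p) := by
  have hD : (fun p : classesD QB => lineC k QB p.1 (M p.1)) ∈ imIdeal k QB ↔ _ :=
    mem_imIdeal_iff (c := fun p => meanC k QB p (M p)) fun p => rfl
  constructor
  · intro h
    have hE : ∀ p : classesE QB, resI k QB p.1 (M p.1) = 0 ∧ lineC k QB p.1 (M p.1) = 0 := by
      intro p
      have := congrFun (congrArg (fun d => d.left.1) h) p
      exact ⟨congrArg (fun e => e.left) this, congrArg (fun e => e.right) this⟩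
    have hA := congrArg (fun d => d.left.2) h
    have hS : ∀ p, slC k QB p (M p) = 0 := by
      intro p
      by_cases hp : p ∈ classesS QB
      · exact congrFun (congrArg (fun d => d.right) h) ⟨p, hp⟩
      · exact slC_eq_zero hp _
    have hdec : ∀ p, M p = (resI k QB p (M p)).1 + (lineC k QB p (M p)).1 := by
      intro p
      conv_lhs => rw [eq_sum_components (hM p), hS]
      have h0 : extC k QB p 0 = 0 := by ext b a; simp [extC]
      exact (congrArg _ h0).trans (add_zero _)
    obtain ⟨g, hg⟩ := hD.1 (LieSubmodule.Quotient.mk_eq_zero'.1 hA)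
    refine ⟨g, fun p => Matrix.ext fun b a => ?_⟩
    rw [hg p ⟨a⟩]
    split_ifs with hp
    -- On a class in $\overline D$ there is no $Q_B$ row and $I_\alpha$ is the full identity matrix,
    -- so $M$ is scalar.
    · have ha : ∀ a : Arr p, a ∉ QB p.1 p.2 := fun a ha => hp.2 ⟨a, ha⟩
      conv_lhs => rw [hdec p]
      rw [Matrix.add_apply, resI_apply, if_pos (Or.inr (ha b)), zero_add, coe_lineC]
      simp [elI, ha, Matrix.one_apply]
    · rw [zero_smul, Matrix.zero_apply]
      by_cases ha : a ∈ QB p.1 p.2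
      · exact hM p b a ha
      · have hpE : p ∈ classesE QB := ⟨⟨⟨a, ha⟩⟩, by
          by_contra hb
          exact hp ⟨⟨⟨a, ha⟩⟩, hb⟩⟩
        rw [hdec p, (hE ⟨p, hpE⟩).1, (hE ⟨p, hpE⟩).2]
        exact add_zero (0 : k)
  · rintro ⟨g, hg⟩
    -- A diagonal entry at an arrow of $Q_B$ lies in a zero column, so $g$ agrees at the ends of
    -- that arrow; this kills the whole parallel class.
    have hQ : ∀ (p : V × V) (a : Arr p), a ∈ QB p.1 p.2 → g p.1 - g p.2 = 0 := by
      intro p a ha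
      have := hM p a a ha
      rw [hg p] at this
      simpa using this
    have hres : ∀ p, resC k QB p (M p) = (g p.1 - g p.2) • 1 +
        (0 : LieAlgebra.SpecialLinear.sl (CArr QB p) k).1 := by
      intro p
      ext b a
      rw [hg p]
      change (g p.1 - g p.2) * (1 : ParLie k p) b.1 a.1 =
        (g p.1 - g p.2) * (1 : Matrix (CArr QB p) (CArr QB p) k) b a + 0
      simp [Matrix.one_apply, Subtype.ext_iff]
    have hE : ∀ p : classesE QB, M p.1 = 0 := by
      rintro ⟨p, hp, b, hb⟩
      rw [hg, hQ p b hb, zero_smul]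
    refine LieAlgebra.SemiDirectSum.ext (Prod.ext (funext fun p =>
      LieAlgebra.SemiDirectSum.ext ?_ ?_) ?_) (funext fun p => ?_)
    · exact (congrArg (resI k QB p.1) (hE p)).trans (map_zero _)
    · exact (congrArg (lineC k QB p.1) (hE p)).trans (map_zero _)
    · refine LieSubmodule.Quotient.mk_eq_zero'.2 (hD.2 ⟨g, fun p ⟨a⟩ => ?_⟩)
      split_ifs with hp
      · exact (meanC_eq hp.1 (hres p)).symm
      · by_cases ha : a ∈ QB p.1 p.2
        · exact hQ p a ha
        · obtain ⟨b, hb⟩ : ∃ b : Arr p, b ∈ QB p.1 p.2 := by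
            by_contra hb
            exact hp ⟨⟨⟨a, ha⟩⟩, hb⟩
          exact hQ p b hb
    · exact slC_eq p.2.1 (hres p.1)

theorem exists_toDecomp_eq (d : Decomp k QB) : ∃ M : ∀ p : V × V, ParLie k p,
    (∀ (p : V × V) (b a : Arr p), a ∈ QB p.1 p.2 → M p b a = 0) ∧ toDecomp k QB M = d := by
  obtain ⟨⟨e, q⟩, s⟩ := d
  obtain ⟨x, rfl⟩ := LieSubmodule.Quotient.surjective_mk' _ q
  let N : ∀ p, frakI k QB p := fun p => if h : p ∈ classesE QB then (e ⟨p, h⟩).left else 0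
  -- The $I_\alpha$ component comes from the $\overline E$ factor or from a chosen lift `x` of the
  -- class in $\mathfrak a$; the two sets of classes are disjoint.
  let l : ∀ p, lineI k QB p := fun p => if h : p ∈ classesE QB then (e ⟨p, h⟩).right else
    if h : p ∈ classesD QB then x ⟨p, h⟩ else 0
  let t : ∀ p, LieAlgebra.SpecialLinear.sl (CArr QB p) k := fun p =>
    if h : p ∈ classesS QB then s ⟨p, h⟩ else 0
  refine ⟨fun p => (N p).1 + (l p).1 + extC k QB p (t p).1,
    fun p => frakI_add_lineI_add_extC_apply _ _ _, ?_⟩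
  refine LieAlgebra.SemiDirectSum.ext (Prod.ext (funext fun p =>
      LieAlgebra.SemiDirectSum.ext ?_ ?_) ?_) (funext fun p => ?_)
  · refine (components_eq p.2.1 (N p.1) (l p.1) (t p.1)).1.trans ?_
    simp only [N, dif_pos p.2]
  · refine (components_eq p.2.1 (N p.1) (l p.1) (t p.1)).2.1.trans ?_
    simp only [l, dif_pos p.2]
  · refine congrArg LieSubmodule.Quotient.mk (funext fun p => ?_)
    refine (components_eq p.2.1 (N p.1) (l p.1) (t p.1)).2.1.trans ?_
    have hp : p.1 ∉ classesE QB := fun h => p.2.2 h.2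
    simp only [l, dif_neg hp, dif_pos p.2]
  · refine (components_eq p.2.1 (N p.1) (l p.1) (t p.1)).2.2.trans ?_
    simp only [t, dif_pos p.2]

end ToDecomp

/-! ### The isomorphism of Lie algebras -/

variable {k V A : Type*} [Field k] [CharZero k] [Quiver V] [Fintype V]
  [∀ i j : V, Fintype (i ⟶ j)] [Ring A] [Algebra k A]

/-- The projection of the relative derivations to the decomposition. -/
def ArrowBasis.relDerToDecomp (β : ArrowBasis k V A) (QB : WideSubquiver V) :
    relDer k (β.subalgebra QB) →ₗ⁅k⁆ Decomp k QB where
  toFun f := toDecomp k QB fun p => β.mat p f.1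
  map_add' f g := by
    rw [← map_add]
    exact congrArg _ (funext fun p => map_add (β.mat p) f.1 g.1)
  map_smul' c f := by
    rw [RingHom.id_apply, ← map_smul]
    exact congrArg _ (funext fun p => map_smul (β.mat p) c f.1)
  map_lie' {f g} := by
    rw [← toDecomp_lie (ArrowBasis.mat_apply_of_mem f.2) (ArrowBasis.mat_apply_of_mem g.2)]
    exact congrArg _ (funext fun p => ArrowBasis.mat_lie f.2 g.2 p)

theorem ArrowBasis.relDerToDecomp_surjective (β : ArrowBasis k V A) (QB : WideSubquiver V) :
    Function.Surjective (β.relDerToDecomp QB) := by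
  intro d
  obtain ⟨M, hM, rfl⟩ := exists_toDecomp_eq d
  exact ⟨⟨β.derOf M, derOf_mem_relDer hM⟩,
    congrArg (toDecomp k QB) (funext fun p => mat_derOf M p)⟩

theorem ArrowBasis.ker_relDerToDecomp (β : ArrowBasis k V A) (QB : WideSubquiver V) :
    (β.relDerToDecomp QB).ker = relInn k (β.subalgebra QB) := by
  ext f
  rw [LieHom.mem_ker, mem_relInn_iff]
  exact toDecomp_eq_zero_iff (mat_apply_of_mem f.2)

theorem ArrowBasis.nonempty_lieEquiv (β : ArrowBasis k V A) (QB : WideSubquiver V) :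
    Nonempty (HH1 k (β.subalgebra QB) ≃ₗ⁅k⁆ Decomp k QB) := by
  have h := (LieHom.range_eq_top _).2 (β.relDerToDecomp_surjective QB)
  have e := (β.relDerToDecomp QB).quotKerEquivRange
  rw [h, β.ker_relDerToDecomp QB] at e
  exact ⟨e.trans LieSubalgebra.topEquiv⟩

end RelHH

theorem mainTheorem6 {k V A : Type*} [Field k] [CharZero k] [Quiver V] [Fintype V]
    [∀ i j : V, Fintype (i ⟶ j)] [Ring A] [Algebra k A]
    (QB : WideSubquiver V) (B : Subalgebra k A) (ν : RelHH.PathAlgebra k V →ₐ[k] A)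
    (hν : RelHH.IsRadSqZeroPair ν QB B) :
    Nonempty (RelHH.HH1 k B ≃ₗ⁅k⁆ RelHH.Decomp k QB) ∧ IsLieAbelian (RelHH.frakA k QB) := by
  obtain ⟨β, rfl⟩ := hν.exists_arrowBasis
  exact ⟨β.nonempty_lieEquiv QB, RelHH.frakA_isLieAbelian⟩
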